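/- **Theorem (Completeness of ctACPps).** Let $A$ be a finite set of actions, $\delta\notin A$, $A_\delta=A\cup\{\delta\}$, let $\mathrm{At}$ be a finite set of atomic propositions, and let $|:A_\delta\times A_\delta\to A_\delta$ be a commutative and associative (communication) function with $\delta\mid a=\delta$ for all $a\in A_\delta$. For all closed process terms $p,q$ of ctACPps, if $p$ and $q$ are (splitting-)bisimulation equivalent, then $p=q$ is derivable from the axioms of ctACPps. The notions are as follows. *Logic.* Propositions are built from $P\in\mathrm{At}$ and $\mathsf F$ by $\neg,\wedge,\vee,\supset$; $\mathsf T:=\neg\mathsf F$, $\varphi\equiv\psi:=(\varphi\supset\psi)\wedge(\psi\supset\varphi)$, and $\varphi\Leftrightarrow\psi:=(\varphi\equiv\psi)\wedge(\neg\varphi\equiv\neg\psi)$. The relation $\vdash$ is given by modus ponens and the axiom schemas $A\supset(B\supset A)$; $(A\supset(B\supset C))\supset((A\supset B)\supset(A\supset C))$; $((A\supset B)\supset A)\supset A$; $\mathsf F\supset A$; $(A\wedge B)\supset A$; $(A\wedge B)\supset B$; $A\supset(B\supset(A\wedge B))$; $A\supset(A\vee B)$; $B\supset(A\vee B)$; $(A\supset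 C)\supset((B\supset C)\supset((A\vee B)\supset C))$; $\neg\neg A\equiv A$; $\neg(A\supset B)\equiv A\wedge\neg B$; $\neg(A\wedge B)\equiv\neg A\vee\neg B$; $\neg(A\vee B)\equiv\neg A\wedge\neg B$; $A\vee\neg A$. A valuation $\nu$ maps propositions to $\{t,f,b\}$ such that $\nu(\mathsf F)=f$; $\nu(\neg A)$ is $t,f,b$ if $\nu(A)$ is $f,t,b$, respectively; $\nu(A\wedge B)$ and $\nu(A\vee B)$ are the minimum and the maximum for the order $f<b<t$; $\nu(A\supset B)$ is $t$ if $\nu(A)=f$ and $\nu(B)$ otherwise. Write $A\Leftrightarrow_{\mathrm s}B$ if $\nu(A)=\nu(B)$ for every $\nu$, and $[\mathsf F]=\{A: A\Leftrightarrow_{\mathrm s}\mathsf F\}$. *Terms.* Closed process terms are built from the constants $a\in A_\delta$ and $\bot$ (inaccessible process) by $x+y$, $x\cdot y$, guarded command $\varphi{:\to}\,x$, signal emission $\varphi\triangleright x$, parallel composition $x\parallel y$, left merge $x\lfloor\!\lfloor y$, communication merge $x\mid y$, and encapsulation $\partial_H(x)$ for $H\subseteq A$ ($\varphi$ a proposition).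 *Axioms.* Derivability is derivability in two-sorted equational logic from the following axioms, where $x,y,z$ are process variables, $a,b,c\in A_\delta$, $H\subseteq A$, and $\varphi,\psi$ are propositions: - $\varphi=\psi$ if $\vdash\varphi\Leftrightarrow\psi$; - $x+y=y+x$; $(x+y)+z=x+(y+z)$; $x+x=x$; $(x+y)\cdot z=x\cdot z+y\cdot z$; $(x\cdot y)\cdot z=x\cdot(y\cdot z)$; $x+\delta=x$; $\delta\cdot x=\delta$; - $\mathsf T{:\to}\,x=x$; $\mathsf F{:\to}\,x=\delta$; $\varphi{:\to}\,\delta=\delta$; $\varphi{:\to}(x+y)=(\varphi{:\to}\,x)+(\varphi{:\to}\,y)$; $\varphi{:\to}(x\cdot y)=(\varphi{:\to}\,x)\cdot y$; $\varphi{:\to}(\psi{:\to}\,x)=(\varphi\wedge\psi){:\to}\,x$; $(\varphi\vee\psi){:\to}\,x=(\varphi{:\to}\,x)+(\psi{:\to}\,x)$; - $x+\bot=\bot$; $\bot\cdot x=\bot$; $a\cdot\bot=\delta$; - $\mathsf T\triangleright x=x$; $\mathsf F\triangleright x=\bot$; $\varphi\triangleright\bot=\bot$; $(\varphi\triangleright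 x)+y=\varphi\triangleright(x+y)$; $(\varphi\triangleright x)\cdot y=\varphi\triangleright(x\cdot y)$; $\varphi\triangleright(\psi\triangleright x)=(\varphi\wedge\psi)\triangleright x$; $\varphi\triangleright(\varphi{:\to}\,x)=\varphi\triangleright x$; $\varphi{:\to}(\psi\triangleright x)=(\varphi\supset\psi)\triangleright(\varphi{:\to}\,x)$; - $x\parallel y=x\lfloor\!\lfloor y+y\lfloor\!\lfloor x+x\mid y$; $a\lfloor\!\lfloor x=a\cdot x+\partial_A(x)$; $(a\cdot x)\lfloor\!\lfloor y=a\cdot(x\parallel y)+\partial_A(y)$; $(x+y)\lfloor\!\lfloor z=x\lfloor\!\lfloor z+y\lfloor\!\lfloor z$; $(a\cdot x)\mid b=(a\mid b)\cdot x$; $a\mid(b\cdot x)=(a\mid b)\cdot x$; $(a\cdot x)\mid(b\cdot y)=(a\mid b)\cdot(x\parallel y)$; $(x+y)\mid z=x\mid z+y\mid z$; $x\mid(y+z)=x\mid y+x\mid z$; - $(\varphi{:\to}\,x)\lfloor\!\lfloor y=\varphi{:\to}(x\lfloor\!\lfloor y)+\partial_A(y)$; $(\varphi{:\to}\,x)\mid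 y=\varphi{:\to}(x\mid y)+\partial_A(y)$; $x\mid(\varphi{:\to}\,y)=\varphi{:\to}(x\mid y)+\partial_A(x)$; $\partial_H(\varphi{:\to}\,x)=\varphi{:\to}\,\partial_H(x)$; - $a\mid b=b\mid a$; $(a\mid b)\mid c=a\mid(b\mid c)$; $\delta\mid a=\delta$; and on constants the term $a\mid b$ equals the constant that is the value of the communication function at $(a,b)$; - $\partial_H(a)=a$ if $a\notin H$; $\partial_H(a)=\delta$ if $a\in H$; $\partial_H(x+y)=\partial_H(x)+\partial_H(y)$; $\partial_H(x\cdot y)=\partial_H(x)\cdot\partial_H(y)$; - $(\varphi\triangleright x)\lfloor\!\lfloor y=\varphi\triangleright(x\lfloor\!\lfloor y)$; $(\varphi\triangleright x)\mid y=\varphi\triangleright(x\mid y)$; $x\mid(\varphi\triangleright y)=\varphi\triangleright(x\mid y)$; $\partial_H(\varphi\triangleright x)=\varphi\triangleright\partial_H(x)$. *Signals.* $s(\bot)=\mathsf F$; $s(a)=\mathsf T$ for $a\in A_\delta$; $s(x\cdot y)=s(\partial_H(x))=s(x)$; $s(\psi{:\to}\,x)=\psi\supset s(x)$; $s(\psi\triangleright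 x)=\psi\wedge s(x)$; and $s(x+y)=s(x\parallel y)=s(x\lfloor\!\lfloor y)=s(x\mid y)=s(x)\wedge s(y)$. *Transitions.* The relations $x\xrightarrow{\varphi,a}\surd$ (termination) and $x\xrightarrow{\varphi,a}x'$ (step), for $a\in A$, are the least relations closed under the following rules. A clause with target $\xi$ is meant both for $\xi=\surd$ and for $\xi$ a process term, and $\mathrm{ok}(x)$ means $s(x)\notin[\mathsf F]$. - $a\xrightarrow{\mathsf T,a}\surd$ for $a\in A$. - If $x\xrightarrow{\varphi,a}\xi$ or $y\xrightarrow{\varphi,a}\xi$, and $\mathrm{ok}(x+y)$, then $x+y\xrightarrow{\varphi,a}\xi$. - If $x\xrightarrow{\varphi,a}\surd$ and $\mathrm{ok}(y)$, then $x\cdot y\xrightarrow{\varphi,a}y$; if $x\xrightarrow{\varphi,a}x'$, then $x\cdot y\xrightarrow{\varphi,a}x'\cdot y$. - If $x\xrightarrow{\varphi,a}\xi$ and $\varphi\wedge\psi\notin[\mathsf F]$, then $\psi{:\to}\,x\xrightarrow{\varphi\wedge\psi,a}\xi$. - If $x\xrightarrow{\varphi,a}\xi$ and $\mathrm{ok}(\psi\triangleright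 x)$, then $\psi\triangleright x\xrightarrow{\varphi,a}\xi$. - If $\mathrm{ok}(x\parallel y)$: from $x\xrightarrow{\varphi,a}\surd$ and $\mathrm{ok}(y)$ infer $x\parallel y\xrightarrow{\varphi,a}y$; from $y\xrightarrow{\varphi,a}\surd$ and $\mathrm{ok}(x)$ infer $x\parallel y\xrightarrow{\varphi,a}x$; from $x\xrightarrow{\varphi,a}x'$ and $\mathrm{ok}(x'\parallel y)$ infer $x\parallel y\xrightarrow{\varphi,a}x'\parallel y$; from $y\xrightarrow{\varphi,a}y'$ and $\mathrm{ok}(x\parallel y')$ infer $x\parallel y\xrightarrow{\varphi,a}x\parallel y'$. - If $\mathrm{ok}(x\lfloor\!\lfloor y)$: from $x\xrightarrow{\varphi,a}\surd$ and $\mathrm{ok}(y)$ infer $x\lfloor\!\lfloor y\xrightarrow{\varphi,a}y$; from $x\xrightarrow{\varphi,a}x'$ and $\mathrm{ok}(x'\parallel y)$ infer $x\lfloor\!\lfloor y\xrightarrow{\varphi,a}x'\parallel y$. - Let $\mathbin{\square}$ be $\parallel$ or $\mid$, let $a\mid b=c\in A$ (communication function), $\varphi\wedge\psi\notin[\mathsf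 F]$ and $\mathrm{ok}(x\mathbin{\square}y)$. If $x\xrightarrow{\varphi,a}\xi$ and $y\xrightarrow{\psi,b}\eta$, then $x\mathbin{\square}y\xrightarrow{\varphi\wedge\psi,c}\zeta$, where $\zeta=\surd$ if $\xi=\eta=\surd$; $\zeta=\eta$ if only $\xi=\surd$; $\zeta=\xi$ if only $\eta=\surd$; and $\zeta=\xi\parallel\eta$, provided that $\mathrm{ok}(\xi\parallel\eta)$, if neither is $\surd$. - If $x\xrightarrow{\varphi,a}\surd$ and $a\notin H$, then $\partial_H(x)\xrightarrow{\varphi,a}\surd$; if $x\xrightarrow{\varphi,a}x'$ and $a\notin H$, then $\partial_H(x)\xrightarrow{\varphi,a}\partial_H(x')$. *Bisimulation.* A bisimulation is a relation $R$ on closed process terms such that $(p,q)\in R$ implies: (i) $s(p)\Leftrightarrow_{\mathrm s}s(q)$; (ii) if $p\xrightarrow{\varphi,a}p'$, then for every valuation $\nu$ with $\nu(s(p))\ne f$ and $\nu(\varphi)\ne f$ there are $\psi,q'$ with $\nu(\varphi)=\nu(\psi)$, $q\xrightarrow{\psi,a}q'$ and $(p',q')\in R$; (iii) if $p\xrightarrow{\varphi,a}\surd$,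 then for every valuation $\nu$ with $\nu(s(p))\ne f$ and $\nu(\varphi)\ne f$ there is $\psi$ with $\nu(\varphi)=\nu(\psi)$ and $q\xrightarrow{\psi,a}\surd$; (iv) the conditions symmetric to (ii) and (iii), with the roles of $p$ and $q$ exchanged. Terms $p,q$ are bisimulation equivalent if some bisimulation contains $(p,q)$. -/

import Mathlib

namespace CtACPps

/-! ### The paraconsistent logic LP with implication and falsity -/

/-- Formulas over a set `P` of propositional variables. With the atomic propositions as variables
these are exactly the closed terms of sort proposition. -/
inductive Fm (P : Type*) where
  | atom : P → Fm P
  | fls : Fm P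
  | neg : Fm P → Fm P
  | conj : Fm P → Fm P → Fm P
  | disj : Fm P → Fm P → Fm P
  | impl : Fm P → Fm P → Fm P

namespace Fm

variable {P : Type*}

/-- Truth: `¬ F`. -/
def tru : Fm P := neg fls

/-- Bi-implication: `(A → B) ∧ (B → A)`. -/
def biimpl (A B : Fm P) : Fm P := conj (impl A B) (impl B A)

/-- Internalized logical equivalence: `(A ↔ B) ∧ (¬ A ↔ ¬ B)`. -/
def iffs (A B : Fm P) : Fm P := conj (biimpl A B) (biimpl (neg A) (neg B))

end Fm

/-- The syntactic consequence relation `Γ ⊢ A` given by the Hilbert-style proof system. -/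
inductive Entails {P : Type*} (Γ : Set (Fm P)) : Fm P → Prop where
  | hyp {A} : A ∈ Γ → Entails Γ A
  | mp {A B} : Entails Γ A → Entails Γ (.impl A B) → Entails Γ B
  | k (A B) : Entails Γ (.impl A (.impl B A))
  | s (A B C) : Entails Γ
      (.impl (.impl A (.impl B C)) (.impl (.impl A B) (.impl A C)))
  | peirce (A B) : Entails Γ (.impl (.impl (.impl A B) A) A)
  | exFalso (A) : Entails Γ (.impl .fls A)
  | conjLeft (A B) : Entails Γ (.impl (.conj A B) A)
  | conjRight (A B) : Entails Γ (.impl (.conj A B) B)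
  | conjIntro (A B) : Entails Γ (.impl A (.impl B (.conj A B)))
  | disjLeft (A B) : Entails Γ (.impl A (.disj A B))
  | disjRight (A B) : Entails Γ (.impl B (.disj A B))
  | disjElim (A B C) : Entails Γ
      (.impl (.impl A C) (.impl (.impl B C) (.impl (.disj A B) C)))
  | negNeg (A) : Entails Γ (.biimpl (.neg (.neg A)) A)
  | negImpl (A B) : Entails Γ (.biimpl (.neg (.impl A B)) (.conj A (.neg B)))
  | negConj (A B) : Entails Γ (.biimpl (.neg (.conj A B)) (.disj (.neg A) (.neg B)))
  | negDisj (A B) : Entails Γ (.biimpl (.neg (.disj A B)) (.conj (.neg A) (.neg B)))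
  | em (A) : Entails Γ (.disj A (.neg A))

/-- The truth values: true, false, both true and false. -/
inductive TV where
  | t
  | f
  | b

namespace TV

def neg : TV → TV
  | f => t
  | t => f
  | b => b

def conj : TV → TV → TV
  | t, t => t
  | f, _ => f
  | _, f => f
  | _, _ => b

def disj : TV → TV → TV
  | f, f => f
  | t, _ => t
  | _, t => t
  | _, _ => b

def impl : TV → TV → TV
  | f, _ => t
  | _, y => y

end TV

/-- The value of a formula under the valuation determined by an assignment `ν` of truth values
to the propositional variables. A valuation is determined by its values on the variables, and
every assignment extends to a valuation. -/
def Fm.eval {P : Type*} (ν : P → TV) : Fm P → TV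
  | .atom p => ν p
  | .fls => .f
  | .neg A => (A.eval ν).neg
  | .conj A B => (A.eval ν).conj (B.eval ν)
  | .disj A B => (A.eval ν).disj (B.eval ν)
  | .impl A B => (A.eval ν).impl (B.eval ν)

/-- Logical equivalence: equal value under every valuation. -/
def LEqv {P : Type*} (A B : Fm P) : Prop := ∀ ν : P → TV, A.eval ν = B.eval ν

/-- `A` belongs to the logical equivalence class of falsity. -/
def IsFalsity {P : Type*} (A : Fm P) : Prop := LEqv A .fls

/-! ### Closed process terms -/

/-- Closed terms of sort process, for actions `Act` and atomic propositions `P`. Elements of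
`Option Act` are the actions together with deadlock, which is `none`. -/
inductive Proc (Act P : Type*) where
  /-- an action constant (`some a`) or the deadlock constant (`none`) -/
  | const : Option Act → Proc Act P
  /-- the inaccessible process -/
  | nex : Proc Act P
  /-- alternative composition -/
  | alt : Proc Act P → Proc Act P → Proc Act P
  /-- sequential composition -/
  | seq : Proc Act P → Proc Act P → Proc Act P
  /-- guarded command -/
  | gc : Fm P → Proc Act P → Proc Act P
  /-- signal emission -/
  | emi : Fm P → Proc Act P → Proc Act P
  /-- parallel composition -/
  | par : Proc Act P → Proc Act P → Proc Act P
  /-- left merge -/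
  | leftm : Proc Act P → Proc Act P → Proc Act P
  /-- communication merge -/
  | comm : Proc Act P → Proc Act P → Proc Act P
  /-- encapsulation of a set of actions -/
  | encap : Set Act → Proc Act P → Proc Act P

namespace Proc

/-- The deadlock constant. -/
abbrev dead {Act P : Type*} : Proc Act P := const none

/-- The constant of an action. -/
abbrev act {Act P : Type*} (a : Act) : Proc Act P := const (some a)

end Proc

/-! ### Axioms and derivability -/

section Derivability

open Proc

/-- The closed substitution instances of the axioms of sort process. -/
inductive Ax {Act P : Type*} (γ : Option Act → Option Act → Option Act) :
    Proc Act P → Proc Act P → Prop where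
  | A1 (x y) : Ax γ (alt x y) (alt y x)
  | A2 (x y z) : Ax γ (alt (alt x y) z) (alt x (alt y z))
  | A3 (x) : Ax γ (alt x x) x
  | A4 (x y z) : Ax γ (seq (alt x y) z) (alt (seq x z) (seq y z))
  | A5 (x y z) : Ax γ (seq (seq x y) z) (seq x (seq y z))
  | A6 (x) : Ax γ (alt x dead) x
  | A7 (x) : Ax γ (seq dead x) dead
  | GC1 (x) : Ax γ (gc .tru x) x
  | GC2 (x) : Ax γ (gc .fls x) dead
  | GC3 (φ) : Ax γ (gc φ dead) dead
  | GC4 (φ x y) : Ax γ (gc φ (alt x y)) (alt (gc φ x) (gc φ y))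
  | GC5 (φ x y) : Ax γ (gc φ (seq x y)) (seq (gc φ x) y)
  | GC6 (φ ψ x) : Ax γ (gc φ (gc ψ x)) (gc (.conj φ ψ) x)
  | GC7 (φ ψ x) : Ax γ (gc (.disj φ ψ) x) (alt (gc φ x) (gc ψ x))
  | NE1 (x) : Ax γ (alt x nex) nex
  | NE2 (x) : Ax γ (seq nex x) nex
  | NE3 (a) : Ax γ (seq (const a) nex) dead
  | SE1 (x) : Ax γ (emi .tru x) x
  | SE2 (x) : Ax γ (emi .fls x) nex
  | SE3 (φ) : Ax γ (emi φ nex) nex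
  | SE4 (φ x y) : Ax γ (alt (emi φ x) y) (emi φ (alt x y))
  | SE5 (φ x y) : Ax γ (seq (emi φ x) y) (emi φ (seq x y))
  | SE6 (φ ψ x) : Ax γ (emi φ (emi ψ x)) (emi (.conj φ ψ) x)
  | SE7 (φ x) : Ax γ (emi φ (gc φ x)) (emi φ x)
  | SE8 (φ ψ x) : Ax γ (gc φ (emi ψ x)) (emi (.impl φ ψ) (gc φ x))
  | CM1 (x y) : Ax γ (par x y) (alt (alt (leftm x y) (leftm y x)) (comm x y))
  | CM2S (a x) : Ax γ (leftm (const a) x) (alt (seq (const a) x) (encap Set.univ x))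
  | CM3S (a x y) : Ax γ (leftm (seq (const a) x) y)
      (alt (seq (const a) (par x y)) (encap Set.univ y))
  | CM4 (x y z) : Ax γ (leftm (alt x y) z) (alt (leftm x z) (leftm y z))
  | CM5 (a b x) : Ax γ (comm (seq (const a) x) (const b))
      (seq (comm (const a) (const b)) x)
  | CM6 (a b x) : Ax γ (comm (const a) (seq (const b) x))
      (seq (comm (const a) (const b)) x)
  | CM7 (a b x y) : Ax γ (comm (seq (const a) x) (seq (const b) y))
      (seq (comm (const a) (const b)) (par x y))
  | CM8 (x y z) : Ax γ (comm (alt x y) z) (alt (comm x z) (comm y z))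
  | CM9 (x y z) : Ax γ (comm x (alt y z)) (alt (comm x y) (comm x z))
  | GC8S (φ x y) : Ax γ (leftm (gc φ x) y) (alt (gc φ (leftm x y)) (encap Set.univ y))
  | GC9S (φ x y) : Ax γ (comm (gc φ x) y) (alt (gc φ (comm x y)) (encap Set.univ y))
  | GC10S (φ x y) : Ax γ (comm x (gc φ y)) (alt (gc φ (comm x y)) (encap Set.univ x))
  | GC11 (H φ x) : Ax γ (encap H (gc φ x)) (gc φ (encap H x))
  | C1 (a b) : Ax γ (comm (const a) (const b)) (comm (const b) (const a))
  | C2 (a b c) : Ax γ (comm (comm (const a) (const b)) (const c))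
      (comm (const a) (comm (const b) (const c)))
  | C3 (a) : Ax γ (comm dead (const a)) dead
  /-- On constants, communication merge is the given communication function. -/
  | CF (a b) : Ax γ (comm (const a) (const b)) (const (γ a b))
  /-- `D1` for an action not in `H`, and for deadlock, which is in no set of actions. -/
  | D1 (H : Set Act) (a : Option Act) : (∀ a' ∈ H, a ≠ some a') →
      Ax γ (encap H (const a)) (const a)
  | D2 (H : Set Act) (a : Act) : a ∈ H → Ax γ (encap H (act a)) dead
  | D3 (H x y) : Ax γ (encap H (alt x y)) (alt (encap H x) (encap H y))
  | D4 (H x y) : Ax γ (encap H (seq x y)) (seq (encap H x) (encap H y))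
  | SE9 (φ x y) : Ax γ (leftm (emi φ x) y) (emi φ (leftm x y))
  | SE10 (φ x y) : Ax γ (comm (emi φ x) y) (emi φ (comm x y))
  | SE11 (φ x y) : Ax γ (comm x (emi φ y)) (emi φ (comm x y))
  | SE12 (H φ x) : Ax γ (encap H (emi φ x)) (emi φ (encap H x))

/-- Derivable equations between closed terms of sort proposition: axiom IMP and the rules of
equational logic. -/
inductive PropDer {P : Type*} : Fm P → Fm P → Prop where
  | imp {φ ψ} : Entails ∅ (.iffs φ ψ) → PropDer φ ψ
  | refl (φ) : PropDer φ φ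
  | symm {φ ψ} : PropDer φ ψ → PropDer ψ φ
  | trans {φ ψ χ} : PropDer φ ψ → PropDer ψ χ → PropDer φ χ
  | neg {φ φ'} : PropDer φ φ' → PropDer (.neg φ) (.neg φ')
  | conj {φ φ' ψ ψ'} : PropDer φ φ' → PropDer ψ ψ' → PropDer (.conj φ ψ) (.conj φ' ψ')
  | disj {φ φ' ψ ψ'} : PropDer φ φ' → PropDer ψ ψ' → PropDer (.disj φ ψ) (.disj φ' ψ')
  | impl {φ φ' ψ ψ'} : PropDer φ φ' → PropDer ψ ψ' → PropDer (.impl φ ψ) (.impl φ' ψ')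

/-- `Der γ p q`: the equation `p = q` between closed terms of sort process is derivable from the
axioms in (two-sorted) equational logic. Since there are closed terms of each sort, variables
add no derivable equations between closed terms, so closed instances of the axioms suffice. -/
inductive Der {Act P : Type*} (γ : Option Act → Option Act → Option Act) :
    Proc Act P → Proc Act P → Prop where
  | ax {p q} : Ax γ p q → Der γ p q
  | refl (p) : Der γ p p
  | symm {p q} : Der γ p q → Der γ q p
  | trans {p q r} : Der γ p q → Der γ q r → Der γ p r
  | alt {p p' q q'} : Der γ p p' → Der γ q q' → Der γ (alt p q) (alt p' q')
  | seq {p p' q q'} : Der γ p p' → Der γ q q' → Der γ (seq p q) (seq p' q')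
  | gc {φ φ' p p'} : PropDer φ φ' → Der γ p p' → Der γ (gc φ p) (gc φ' p')
  | emi {φ φ' p p'} : PropDer φ φ' → Der γ p p' → Der γ (emi φ p) (emi φ' p')
  | par {p p' q q'} : Der γ p p' → Der γ q q' → Der γ (par p q) (par p' q')
  | leftm {p p' q q'} : Der γ p p' → Der γ q q' → Der γ (leftm p q) (leftm p' q')
  | comm {p p' q q'} : Der γ p p' → Der γ q q' → Der γ (comm p q) (comm p' q')
  | encap (H) {p p'} : Der γ p p' → Der γ (encap H p) (encap H p')

end Derivability

/-! ### Structural operational semantics -/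

/-- The signal emitted by a closed term. There is exactly one signal rule for each constant and
operator, so the signal emission relation is this function. -/
def Proc.sgn {Act P : Type*} : Proc Act P → Fm P
  | .const _ => .tru
  | .nex => .fls
  | .alt x y => .conj x.sgn y.sgn
  | .seq x _ => x.sgn
  | .gc ψ x => .impl ψ x.sgn
  | .emi ψ x => .conj ψ x.sgn
  | .par x y => .conj x.sgn y.sgn
  | .leftm x y => .conj x.sgn y.sgn
  | .comm x y => .conj x.sgn y.sgn
  | .encap _ x => x.sgn

section Transitions

open Proc

/-- Action termination: `Term γ x φ a` says that `x` can perform the action `a` under condition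
`φ` and then terminate successfully. -/
inductive Term {Act P : Type*} (γ : Option Act → Option Act → Option Act) :
    Proc Act P → Fm P → Act → Prop where
  | act (a) : Term γ (act a) .tru a
  | altLeft {x y φ a} : Term γ x φ a → ¬ IsFalsity (alt x y).sgn → Term γ (alt x y) φ a
  | altRight {x y φ a} : Term γ y φ a → ¬ IsFalsity (alt x y).sgn → Term γ (alt x y) φ a
  | gc {x φ ψ a} : Term γ x φ a → ¬ IsFalsity (.conj φ ψ) → Term γ (gc ψ x) (.conj φ ψ) a
  | emi {x φ ψ a} : Term γ x φ a → ¬ IsFalsity (emi ψ x).sgn → Term γ (emi ψ x) φ a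
  | par {x y φ ψ a b c} : Term γ x φ a → Term γ y ψ b →
      γ (some a) (some b) = some c → ¬ IsFalsity (.conj φ ψ) → ¬ IsFalsity (par x y).sgn →
      Term γ (par x y) (.conj φ ψ) c
  | comm {x y φ ψ a b c} : Term γ x φ a → Term γ y ψ b →
      γ (some a) (some b) = some c → ¬ IsFalsity (.conj φ ψ) → ¬ IsFalsity (comm x y).sgn →
      Term γ (comm x y) (.conj φ ψ) c
  | encap {H : Set Act} {x φ a} : Term γ x φ a → a ∉ H → Term γ (encap H x) φ a

/-- Action step: `Step γ x φ a x'` says that `x` can perform the action `a` under condition `φ`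
and then proceed as `x'`. -/
inductive Step {Act P : Type*} (γ : Option Act → Option Act → Option Act) :
    Proc Act P → Fm P → Act → Proc Act P → Prop where
  | altLeft {x x' y φ a} : Step γ x φ a x' → ¬ IsFalsity (alt x y).sgn →
      Step γ (alt x y) φ a x'
  | altRight {x y y' φ a} : Step γ y φ a y' → ¬ IsFalsity (alt x y).sgn →
      Step γ (alt x y) φ a y'
  | seqTerm {x y φ a} : Term γ x φ a → ¬ IsFalsity y.sgn → Step γ (seq x y) φ a y
  | seqStep {x x' y φ a} : Step γ x φ a x' → Step γ (seq x y) φ a (seq x' y)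
  | gc {x x' φ ψ a} : Step γ x φ a x' → ¬ IsFalsity (.conj φ ψ) →
      Step γ (gc ψ x) (.conj φ ψ) a x'
  | emi {x x' φ ψ a} : Step γ x φ a x' → ¬ IsFalsity (emi ψ x).sgn → Step γ (emi ψ x) φ a x'
  | parLeftTerm {x y φ a} : Term γ x φ a → ¬ IsFalsity (par x y).sgn → ¬ IsFalsity y.sgn →
      Step γ (par x y) φ a y
  | parRightTerm {x y φ a} : Term γ y φ a → ¬ IsFalsity (par x y).sgn → ¬ IsFalsity x.sgn →
      Step γ (par x y) φ a x
  | parLeftStep {x x' y φ a} : Step γ x φ a x' → ¬ IsFalsity (par x y).sgn →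
      ¬ IsFalsity (par x' y).sgn → Step γ (par x y) φ a (par x' y)
  | parRightStep {x y y' φ a} : Step γ y φ a y' → ¬ IsFalsity (par x y).sgn →
      ¬ IsFalsity (par x y').sgn → Step γ (par x y) φ a (par x y')
  | parTermStep {x y y' φ ψ a b c} : Term γ x φ a → Step γ y ψ b y' →
      γ (some a) (some b) = some c → ¬ IsFalsity (.conj φ ψ) → ¬ IsFalsity (par x y).sgn →
      Step γ (par x y) (.conj φ ψ) c y'
  | parStepTerm {x x' y φ ψ a b c} : Step γ x φ a x' → Term γ y ψ b →
      γ (some a) (some b) = some c → ¬ IsFalsity (.conj φ ψ) → ¬ IsFalsity (par x y).sgn →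
      Step γ (par x y) (.conj φ ψ) c x'
  | parStepStep {x x' y y' φ ψ a b c} : Step γ x φ a x' → Step γ y ψ b y' →
      γ (some a) (some b) = some c → ¬ IsFalsity (.conj φ ψ) → ¬ IsFalsity (par x y).sgn →
      ¬ IsFalsity (par x' y').sgn → Step γ (par x y) (.conj φ ψ) c (par x' y')
  | leftmTerm {x y φ a} : Term γ x φ a → ¬ IsFalsity (leftm x y).sgn → ¬ IsFalsity y.sgn →
      Step γ (leftm x y) φ a y
  | leftmStep {x x' y φ a} : Step γ x φ a x' → ¬ IsFalsity (leftm x y).sgn →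
      ¬ IsFalsity (par x' y).sgn → Step γ (leftm x y) φ a (par x' y)
  | commTermStep {x y y' φ ψ a b c} : Term γ x φ a → Step γ y ψ b y' →
      γ (some a) (some b) = some c → ¬ IsFalsity (.conj φ ψ) → ¬ IsFalsity (comm x y).sgn →
      Step γ (comm x y) (.conj φ ψ) c y'
  | commStepTerm {x x' y φ ψ a b c} : Step γ x φ a x' → Term γ y ψ b →
      γ (some a) (some b) = some c → ¬ IsFalsity (.conj φ ψ) → ¬ IsFalsity (comm x y).sgn →
      Step γ (comm x y) (.conj φ ψ) c x'
  | commStepStep {x x' y y' φ ψ a b c} : Step γ x φ a x' → Step γ y ψ b y' →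
      γ (some a) (some b) = some c → ¬ IsFalsity (.conj φ ψ) → ¬ IsFalsity (comm x y).sgn →
      ¬ IsFalsity (par x' y').sgn → Step γ (comm x y) (.conj φ ψ) c (par x' y')
  | encap {H : Set Act} {x x' φ a} : Step γ x φ a x' → a ∉ H →
      Step γ (encap H x) φ a (encap H x')

end Transitions

/-! ### Splitting bisimulation -/

/-- `R` is a (splitting) bisimulation: a transition on one side is matched, separately for each
valuation, by a transition on the other side whose condition has the same value. -/
structure IsBisimulation {Act P : Type*} (γ : Option Act → Option Act → Option Act)
    (R : Proc Act P → Proc Act P → Prop) : Prop where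
  step_left : ∀ p q, R p q → ∀ φ a p', Step γ p φ a p' →
    ∀ ν : P → TV, p.sgn.eval ν ≠ .f → φ.eval ν ≠ .f →
      ∃ ψ q', φ.eval ν = ψ.eval ν ∧ Step γ q ψ a q' ∧ R p' q'
  step_right : ∀ p q, R p q → ∀ ψ a q', Step γ q ψ a q' →
    ∀ ν : P → TV, q.sgn.eval ν ≠ .f → ψ.eval ν ≠ .f →
      ∃ φ p', ψ.eval ν = φ.eval ν ∧ Step γ p φ a p' ∧ R p' q'
  term_left : ∀ p q, R p q → ∀ φ a, Term γ p φ a →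
    ∀ ν : P → TV, p.sgn.eval ν ≠ .f → φ.eval ν ≠ .f →
      ∃ ψ, φ.eval ν = ψ.eval ν ∧ Term γ q ψ a
  term_right : ∀ p q, R p q → ∀ ψ a, Term γ q ψ a →
    ∀ ν : P → TV, q.sgn.eval ν ≠ .f → ψ.eval ν ≠ .f →
      ∃ φ, ψ.eval ν = φ.eval ν ∧ Term γ p φ a
  sgn : ∀ p q, R p q → LEqv p.sgn q.sgn

/-- Bisimulation equivalence. -/
def Bisim {Act P : Type*} (γ : Option Act → Option Act → Option Act) (p q : Proc Act P) : Prop :=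
  ∃ R : Proc Act P → Proc Act P → Prop, IsBisimulation γ R ∧ R p q

end CtACPps

/-! Every closed term is derivably a head normal form: its signal, emitted over a finite sum of
guarded summands `φ :→ a` or `φ :→ a · p'` (`expansion`). The operational rules produce nearly the
same list. Every transition is a summand, and a summand is a transition once its condition and the
signal are non-false at one common valuation and its target is consistent (`trans_of_mem`). What is
left over is harmless: a summand with an inconsistent target vanishes by `a · ⊥ = δ`, and conditions
matter only where the signal is non-false (`emi_gc_congr`).

Let `p` and `q` be bisimilar, and argue by induction on depth. A summand `φ :→ a · p'` of `p` may be
matched by different summands of `q` at different valuations. By induction all these matches have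
targets derivably equal to `p'`, so they can be joined into one summand of `q` by the disjunction of
their conditions. Wherever the signal is non-false, this disjunction has at least the value of `φ`,
so the summand of `p` is absorbed (`emi_sum_absorb`). By symmetry, under their common signal each of
the two sums absorbs the other, so both equal their sum.

Two ingredients support this. Equality of truth values must yield derivable equality of conditions,
which is completeness of the propositional calculus (`LEqv.propDer`). Also, the axioms expand a step
`y → y'` in `x ∥ y` to `y' ∥ x`, where the rules give `x ∥ y'`; commutativity of `∥` therefore has
to be derived first (`mk_par_swap`), from a preliminary expansion. -/

namespace CtACPps

/-! ### Completeness of the propositional proof system -/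

section Logic

variable {P : Type*} {Γ Δ : Set (Fm P)} {A B C : Fm P}

namespace Entails

/-- Induction on derivations in which all axioms are treated alike. -/
theorem induction_axiom {motive : ∀ A : Fm P, Entails Γ A → Prop} {A : Fm P}
    (h : Entails Γ A)
    (hyp : ∀ A, ∀ h : A ∈ Γ, motive A (.hyp h))
    (mp : ∀ A B, ∀ h₁ : Entails Γ A, ∀ h₂ : Entails Γ (.impl A B),
      motive A h₁ → motive _ h₂ → motive B (.mp h₁ h₂))
    (ax : ∀ A, ∀ h : Entails Γ A, (∀ Δ, Entails Δ A) → motive A h) : motive A h := by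
  induction h with
  | hyp h => exact hyp _ h
  | mp h₁ h₂ ih₁ ih₂ => exact mp _ _ h₁ h₂ ih₁ ih₂
  | k => exact ax _ _ fun _ => .k ..
  | s => exact ax _ _ fun _ => .s ..
  | peirce => exact ax _ _ fun _ => .peirce ..
  | exFalso => exact ax _ _ fun _ => .exFalso ..
  | conjLeft => exact ax _ _ fun _ => .conjLeft ..
  | conjRight => exact ax _ _ fun _ => .conjRight ..
  | conjIntro => exact ax _ _ fun _ => .conjIntro ..
  | disjLeft => exact ax _ _ fun _ => .disjLeft ..
  | disjRight => exact ax _ _ fun _ => .disjRight ..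
  | disjElim => exact ax _ _ fun _ => .disjElim ..
  | negNeg => exact ax _ _ fun _ => .negNeg ..
  | negImpl => exact ax _ _ fun _ => .negImpl ..
  | negConj => exact ax _ _ fun _ => .negConj ..
  | negDisj => exact ax _ _ fun _ => .negDisj ..
  | em => exact ax _ _ fun _ => .em ..

theorem mono (h : Entails Γ A) (hΓ : Γ ⊆ Δ) : Entails Δ A := by
  induction h using induction_axiom with
  | hyp A h => exact .hyp (hΓ h)
  | mp _ _ _ _ ih₁ ih₂ => exact .mp ih₁ ih₂
  | ax A _ h => exact h _

theorem impl_self (A : Fm P) : Entails Γ (.impl A A) :=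
  .mp (.k A A) (.mp (.k A (.impl A A)) (.s A (.impl A A) A))

theorem impl_of (B : Fm P) (h : Entails Γ A) : Entails Γ (.impl B A) := .mp h (.k A B)

theorem deduction (h : Entails (insert A Γ) B) : Entails Γ (.impl A B) := by
  induction h using induction_axiom with
  | hyp A h =>
    rcases h with rfl | h
    · exact impl_self _
    · exact impl_of _ (.hyp h)
  | mp _ _ _ _ ih₁ ih₂ => exact .mp ih₁ (.mp ih₂ (.s _ _ _))
  | ax B _ h => exact impl_of _ (h _)

/-- A derivation uses finitely many hypotheses, and these already lie in one member of the chain.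
This is the chain condition for Zorn's lemma. -/
theorem of_directed {c : Set (Set (Fm P))} (hne : c.Nonempty) (hc : IsChain (· ⊆ ·) c)
    (h : Entails (⋃₀ c) A) : ∃ Γ ∈ c, Entails Γ A := by
  induction h using induction_axiom with
  | hyp A h => obtain ⟨Γ, hΓ, h⟩ := h; exact ⟨Γ, hΓ, .hyp h⟩
  | mp _ _ _ _ ih₁ ih₂ =>
    obtain ⟨Γ₁, h₁, e₁⟩ := ih₁
    obtain ⟨Γ₂, h₂, e₂⟩ := ih₂
    rcases hc.total h₁ h₂ with h | h
    · exact ⟨Γ₂, h₂, .mp (e₁.mono h) e₂⟩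
    · exact ⟨Γ₁, h₁, .mp e₁ (e₂.mono h)⟩
  | ax A _ h => exact ⟨_, hne.some_mem, h _⟩

end Entails

/-- `Γ` is maximal among the sets of formulas that do not entail `A`. -/
def MaxAvoiding (Γ : Set (Fm P)) (A : Fm P) : Prop := Maximal (fun Δ => ¬ Entails Δ A) Γ

theorem exists_maxAvoiding (h : ¬ Entails Γ A) : ∃ Δ, Γ ⊆ Δ ∧ MaxAvoiding Δ A := by
  refine zorn_subset_nonempty {Δ | ¬ Entails Δ A} (fun c hc hch hne => ?_) Γ h
  refine ⟨⋃₀ c, fun hA => ?_, fun s hs => Set.subset_sUnion_of_mem hs⟩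
  obtain ⟨Δ, hΔ, hA⟩ := hA.of_directed hne hch
  exact hc hΔ hA

/-! ### Maximal theories and their canonical valuations -/

namespace MaxAvoiding

variable (hm : MaxAvoiding Γ A)
include hm

theorem impl_of_notMem (h : B ∉ Γ) : Entails Γ (.impl B A) := by
  by_contra hB
  refine h (hm.2 (y := insert B Γ) (fun hA => hB hA.deduction) (Set.subset_insert _ _)
    (Set.mem_insert _ _))

theorem mem_iff : B ∈ Γ ↔ Entails Γ B :=
  ⟨.hyp, fun h => by_contra fun hB => hm.1 (.mp h (hm.impl_of_notMem hB))⟩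

theorem mp (h : Entails Γ (.impl B C)) (hB : B ∈ Γ) : C ∈ Γ :=
  hm.mem_iff.2 (.mp (.hyp hB) h)

theorem impl_mem : .impl B C ∈ Γ ↔ (B ∈ Γ → C ∈ Γ) := by
  refine ⟨fun h => hm.mp (.hyp h), fun h => ?_⟩
  by_cases hB : B ∈ Γ
  · exact hm.mem_iff.2 (.impl_of _ (.hyp (h hB)))
  by_contra hBC
  -- Both `B` and `B ⊃ C` entail `A` by maximality. Given `A ⊃ C`, then, `B` yields `A` and hence
  -- `C`; so `B ⊃ C` holds, and with it `A`. Peirce's law turns this into `A` outright.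
  have h₁ : Entails Γ (.impl (.impl A C) A) :=
    Entails.deduction <| .mp (.deduction <| .mp
      (.mp (.hyp (Set.mem_insert _ _))
        ((hm.impl_of_notMem hB).mono
          ((Set.subset_insert _ _).trans (Set.subset_insert _ _))))
      (.hyp (Set.mem_insert_of_mem _ (Set.mem_insert _ _))))
      ((hm.impl_of_notMem hBC).mono (Set.subset_insert _ _))
  exact hm.1 (.mp h₁ (.peirce A C))

theorem fls_notMem : .fls ∉ Γ := fun h => hm.1 (.mp (.hyp h) (.exFalso A))

theorem conj_mem : .conj B C ∈ Γ ↔ B ∈ Γ ∧ C ∈ Γ :=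
  ⟨fun h => ⟨hm.mp (.conjLeft _ _) h, hm.mp (.conjRight _ _) h⟩,
    fun h => hm.mem_iff.2 (.mp (.hyp h.2) (.mp (.hyp h.1) (.conjIntro _ _)))⟩

theorem disj_mem : .disj B C ∈ Γ ↔ B ∈ Γ ∨ C ∈ Γ := by
  refine ⟨fun h => ?_, fun h => h.elim (hm.mp (.disjLeft _ _)) (hm.mp (.disjRight _ _))⟩
  by_contra! hn
  exact hm.1 (.mp (.hyp h) (.mp (hm.impl_of_notMem hn.2)
    (.mp (hm.impl_of_notMem hn.1) (.disjElim _ _ _))))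

theorem mem_congr (h : Entails Γ (.biimpl B C)) : B ∈ Γ ↔ C ∈ Γ := by
  obtain ⟨h₁, h₂⟩ := hm.conj_mem.1 (hm.mem_iff.2 h)
  exact ⟨hm.mp (.hyp h₁), hm.mp (.hyp h₂)⟩

theorem em : B ∈ Γ ∨ .neg B ∈ Γ := hm.disj_mem.1 (hm.mem_iff.2 (.em B))

-- The canonical value of `B` records which of `B` and `¬B` belong to `Γ`, with `b` for both;
-- excluded middle rules out neither. Membership of `B` does not determine membership of `¬B`, so
-- the two equivalences are proved together, and the axioms for negated compounds drive the second
-- one.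
open Classical in
theorem exists_eval : ∃ ν : P → TV, ∀ B : Fm P,
    (B.eval ν ≠ .f ↔ B ∈ Γ) ∧ (B.eval ν ≠ .t ↔ .neg B ∈ Γ) := by
  refine ⟨fun p => if .atom p ∈ Γ then if .neg (.atom p) ∈ Γ then .b else .t else .f,
    fun B => ?_⟩
  induction B with
  | atom p =>
    have := hm.em (B := .atom p)
    simp only [Fm.eval]
    split_ifs <;> simp_all
  | fls =>
    have := hm.em (B := .fls)
    have := hm.fls_notMem
    simp_all [Fm.eval]
  | neg B ih =>
    rw [hm.mem_congr (.negNeg B), ← ih.1, ← ih.2, Fm.eval]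
    generalize B.eval _ = x
    cases x <;> simp [TV.neg]
  | conj B C ihB ihC =>
    rw [hm.mem_congr (.negConj B C), hm.conj_mem, hm.disj_mem, ← ihB.1, ← ihB.2, ← ihC.1,
      ← ihC.2, Fm.eval]
    generalize B.eval _ = x
    generalize C.eval _ = y
    cases x <;> cases y <;> simp [TV.conj]
  | disj B C ihB ihC =>
    rw [hm.mem_congr (.negDisj B C), hm.conj_mem, hm.disj_mem, ← ihB.1, ← ihB.2, ← ihC.1,
      ← ihC.2, Fm.eval]
    generalize B.eval _ = x
    generalize C.eval _ = y
    cases x <;> cases y <;> simp [TV.disj]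
  | impl B C ihB ihC =>
    rw [hm.mem_congr (.negImpl B C), hm.conj_mem, hm.impl_mem, ← ihB.1, ← ihC.1,
      ← ihC.2, Fm.eval]
    generalize B.eval _ = x
    generalize C.eval _ = y
    cases x <;> cases y <;> simp [TV.impl]

end MaxAvoiding

theorem entails_of_valid (h : ∀ ν : P → TV, A.eval ν ≠ .f) : Entails Γ A := by
  by_contra hA
  obtain ⟨Δ, -, hm⟩ := exists_maxAvoiding hA
  obtain ⟨ν, hν⟩ := hm.exists_eval
  exact hm.1 (.hyp ((hν A).1.1 (h ν)))

/-- Internalized equivalence compares the formulas and also their negations, so it never takes the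
value `f` on formulas of equal value, and completeness applies. -/
theorem LEqv.propDer (h : LEqv A B) : PropDer A B := by
  refine .imp (entails_of_valid fun ν => ?_)
  simp only [Fm.iffs, Fm.biimpl, Fm.eval, h ν]
  cases B.eval ν <;> simp [TV.impl, TV.conj, TV.neg]

end Logic
end CtACPps
namespace CtACPps

/-! ### Processes modulo derivable equality -/

section Quotient

variable {Act P : Type*} {γ : Option Act → Option Act → Option Act}

/-- Derivable equality as a setoid. -/
def derSetoid (Act P : Type*) (γ : Option Act → Option Act → Option Act) :
    Setoid (Proc Act P) :=
  ⟨Der γ, .refl, .symm, .trans⟩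

/-- Closed process terms modulo derivable equality. -/
def PCls (Act P : Type*) (γ : Option Act → Option Act → Option Act) : Type _ :=
  Quotient (derSetoid Act P γ)

namespace PCls

/-- The class of a term. -/
def mk (γ : Option Act → Option Act → Option Act) (p : Proc Act P) : PCls Act P γ :=
  Quotient.mk (derSetoid Act P γ) p

theorem ind {motive : PCls Act P γ → Prop} (h : ∀ p, motive (mk γ p)) (x) : motive x :=
  Quotient.ind h x

theorem mk_eq_mk {p q : Proc Act P} : mk γ p = mk γ q ↔ Der γ p q := Quotient.eq

theorem sound {p q : Proc Act P} (h : Ax γ p q) : mk γ p = mk γ q := mk_eq_mk.2 (.ax h)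

def alt : PCls Act P γ → PCls Act P γ → PCls Act P γ :=
  Quotient.map₂ .alt fun _ _ h _ _ h' => .alt h h'

def seq : PCls Act P γ → PCls Act P γ → PCls Act P γ :=
  Quotient.map₂ .seq fun _ _ h _ _ h' => .seq h h'

def par : PCls Act P γ → PCls Act P γ → PCls Act P γ :=
  Quotient.map₂ .par fun _ _ h _ _ h' => .par h h'

def leftm : PCls Act P γ → PCls Act P γ → PCls Act P γ :=
  Quotient.map₂ .leftm fun _ _ h _ _ h' => .leftm h h'

def comm : PCls Act P γ → PCls Act P γ → PCls Act P γ :=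
  Quotient.map₂ .comm fun _ _ h _ _ h' => .comm h h'

def gc (φ : Fm P) : PCls Act P γ → PCls Act P γ :=
  Quotient.map (.gc φ) fun _ _ h => .gc (.refl φ) h

def emi (φ : Fm P) : PCls Act P γ → PCls Act P γ :=
  Quotient.map (.emi φ) fun _ _ h => .emi (.refl φ) h

def encap (H : Set Act) : PCls Act P γ → PCls Act P γ :=
  Quotient.map (.encap H) fun _ _ h => .encap H h

def const (c : Option Act) : PCls Act P γ := mk γ (.const c)

def nex : PCls Act P γ := mk γ .nex

instance : Zero (PCls Act P γ) := ⟨const none⟩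

instance : Add (PCls Act P γ) := ⟨alt⟩

instance : AddCommMonoid (PCls Act P γ) where
  add_assoc x y z := by
    induction x using ind; induction y using ind; induction z using ind
    exact sound (.A2 _ _ _)
  add_comm x y := by
    induction x using ind; induction y using ind; exact sound (.A1 _ _)
  add_zero x := by induction x using ind; exact sound (.A6 _)
  zero_add x := by
    induction x using ind
    exact (sound (.A1 _ _)).trans (sound (.A6 _))
  nsmul := nsmulRec

/-! ### The axioms as equations in the quotient -/

variable (x y z : PCls Act P γ) (φ ψ : Fm P) (H : Set Act)

theorem mk_alt (p q : Proc Act P) : mk γ (.alt p q) = mk γ p + mk γ q := rfl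
theorem mk_seq (p q : Proc Act P) : mk γ (.seq p q) = seq (mk γ p) (mk γ q) := rfl
theorem mk_par (p q : Proc Act P) : mk γ (.par p q) = par (mk γ p) (mk γ q) := rfl
theorem mk_gc (p : Proc Act P) : mk γ (.gc φ p) = gc φ (mk γ p) := rfl
theorem mk_emi (p : Proc Act P) : mk γ (.emi φ p) = emi φ (mk γ p) := rfl
theorem mk_encap (p : Proc Act P) : mk γ (.encap H p) = encap H (mk γ p) := rfl

@[simp] theorem const_none : const none = (0 : PCls Act P γ) := rfl

theorem add_self : x + x = x := by induction x using ind; exact sound (.A3 _)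

theorem add_seq : seq (x + y) z = seq x z + seq y z := by
  induction x using ind; induction y using ind; induction z using ind; exact sound (.A4 _ _ _)

theorem seq_assoc : seq (seq x y) z = seq x (seq y z) := by
  induction x using ind; induction y using ind; induction z using ind; exact sound (.A5 _ _ _)

@[simp] theorem zero_seq : seq 0 x = 0 := by induction x using ind; exact sound (.A7 _)

-- Through this and `emi_congr` the completeness of the logic enters; from here on, conditions and
-- signals are compared by truth tables.
variable {φ ψ} in
theorem gc_congr (h : LEqv φ ψ) : gc φ x = gc ψ x := by
  induction x using ind; exact mk_eq_mk.2 (.gc h.propDer (.refl _))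

variable {φ ψ} in
theorem emi_congr (h : LEqv φ ψ) : emi φ x = emi ψ x := by
  induction x using ind; exact mk_eq_mk.2 (.emi h.propDer (.refl _))

@[simp] theorem gc_tru : gc .tru x = x := by induction x using ind; exact sound (.GC1 _)

@[simp] theorem gc_fls : gc .fls x = 0 := by induction x using ind; exact sound (.GC2 _)

@[simp] theorem gc_zero : gc φ (0 : PCls Act P γ) = 0 := sound (.GC3 _)

theorem gc_add : gc φ (x + y) = gc φ x + gc φ y := by
  induction x using ind; induction y using ind; exact sound (.GC4 _ _ _)

theorem gc_seq : gc φ (seq x y) = seq (gc φ x) y := by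
  induction x using ind; induction y using ind; exact sound (.GC5 _ _ _)

theorem gc_gc : gc φ (gc ψ x) = gc (.conj φ ψ) x := by
  induction x using ind; exact sound (.GC6 _ _ _)

theorem gc_disj : gc (.disj φ ψ) x = gc φ x + gc ψ x := by
  induction x using ind; exact sound (.GC7 _ _ _)

@[simp] theorem const_seq_nex (c : Option Act) : seq (const c) nex = (0 : PCls Act P γ) :=
  sound (.NE3 _)

@[simp] theorem emi_tru : emi .tru x = x := by induction x using ind; exact sound (.SE1 _)

@[simp] theorem emi_fls : emi .fls x = nex := by induction x using ind; exact sound (.SE2 _)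

theorem emi_add_left : emi φ x + y = emi φ (x + y) := by
  induction x using ind; induction y using ind; exact sound (.SE4 _ _ _)

theorem emi_seq : seq (emi φ x) y = emi φ (seq x y) := by
  induction x using ind; induction y using ind; exact sound (.SE5 _ _ _)

theorem emi_emi : emi φ (emi ψ x) = emi (.conj φ ψ) x := by
  induction x using ind; exact sound (.SE6 _ _ _)

theorem emi_add : emi φ x + emi ψ y = emi (.conj φ ψ) (x + y) := by
  rw [emi_add_left, add_comm, emi_add_left, emi_emi, add_comm]

theorem emi_gc_self : emi φ (gc φ x) = emi φ x := by
  induction x using ind; exact sound (.SE7 _ _)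

theorem gc_emi : gc φ (emi ψ x) = emi (.impl φ ψ) (gc φ x) := by
  induction x using ind; exact sound (.SE8 _ _ _)

theorem par_eq : par x y = leftm x y + leftm y x + comm x y := by
  induction x using ind; induction y using ind; exact sound (.CM1 _ _)

theorem const_leftm (c : Option Act) :
    leftm (const c) x = seq (const c) x + encap Set.univ x := by
  induction x using ind; exact sound (.CM2S _ _)

theorem const_seq_leftm (c : Option Act) :
    leftm (seq (const c) x) y = seq (const c) (par x y) + encap Set.univ y := by
  induction x using ind; induction y using ind; exact sound (.CM3S _ _ _)

theorem add_leftm : leftm (x + y) z = leftm x z + leftm y z := by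
  induction x using ind; induction y using ind; induction z using ind; exact sound (.CM4 _ _ _)

theorem const_comm_const (c d : Option Act) :
    comm (const c) (const d) = (const (γ c d) : PCls Act P γ) := sound (.CF _ _)

theorem seq_comm_const (c d : Option Act) :
    comm (seq (const c) x) (const d) = seq (const (γ c d)) x := by
  rw [← const_comm_const]; induction x using ind; exact sound (.CM5 _ _ _)

theorem const_comm_seq (c d : Option Act) :
    comm (const c) (seq (const d) x) = seq (const (γ c d)) x := by
  rw [← const_comm_const]; induction x using ind; exact sound (.CM6 _ _ _)

theorem seq_comm_seq (c d : Option Act) :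
    comm (seq (const c) x) (seq (const d) y) = seq (const (γ c d)) (par x y) := by
  rw [← const_comm_const]
  induction x using ind; induction y using ind; exact sound (.CM7 _ _ _ _)

theorem add_comm_merge : comm (x + y) z = comm x z + comm y z := by
  induction x using ind; induction y using ind; induction z using ind; exact sound (.CM8 _ _ _)

theorem comm_merge_add : comm x (y + z) = comm x y + comm x z := by
  induction x using ind; induction y using ind; induction z using ind; exact sound (.CM9 _ _ _)

theorem gc_leftm : leftm (gc φ x) y = gc φ (leftm x y) + encap Set.univ y := by
  induction x using ind; induction y using ind; exact sound (.GC8S _ _ _)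

theorem gc_comm_merge : comm (gc φ x) y = gc φ (comm x y) + encap Set.univ y := by
  induction x using ind; induction y using ind; exact sound (.GC9S _ _ _)

theorem comm_merge_gc : comm x (gc φ y) = gc φ (comm x y) + encap Set.univ x := by
  induction x using ind; induction y using ind; exact sound (.GC10S _ _ _)

theorem encap_gc : encap H (gc φ x) = gc φ (encap H x) := by
  induction x using ind; exact sound (.GC11 _ _ _)

theorem encap_add : encap H (x + y) = encap H x + encap H y := by
  induction x using ind; induction y using ind; exact sound (.D3 _ _ _)

theorem encap_seq : encap H (seq x y) = seq (encap H x) (encap H y) := by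
  induction x using ind; induction y using ind; exact sound (.D4 _ _ _)

theorem emi_leftm : leftm (emi φ x) y = emi φ (leftm x y) := by
  induction x using ind; induction y using ind; exact sound (.SE9 _ _ _)

theorem emi_comm_merge : comm (emi φ x) y = emi φ (comm x y) := by
  induction x using ind; induction y using ind; exact sound (.SE10 _ _ _)

theorem comm_merge_emi : comm x (emi φ y) = emi φ (comm x y) := by
  induction x using ind; induction y using ind; exact sound (.SE11 _ _ _)

theorem encap_emi : encap H (emi φ x) = emi φ (encap H x) := by
  induction x using ind; exact sound (.SE12 _ _ _)

@[simp] theorem encap_zero : encap H (0 : PCls Act P γ) = 0 := sound (.D1 H none (by simp))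

end PCls

open Classical in
/-- The action remaining after encapsulation, where `none` is deadlock. -/
noncomputable def encapAct (H : Set Act) : Option Act → Option Act
  | none => none
  | some a => if a ∈ H then none else some a

namespace PCls

theorem encap_const (H : Set Act) (c : Option Act) :
    encap H (const c) = (const (encapAct H c) : PCls Act P γ) := by
  rcases c with _ | a
  · exact encap_zero H
  · by_cases h : a ∈ H
    · rw [encapAct, if_pos h]
      exact sound (.D2 H a h)
    · rw [encapAct, if_neg h]
      exact sound (.D1 H (some a) (by rintro b hb ⟨⟩; exact h hb))

/-- The action `c` followed by a process, or by termination. -/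
def pre (c : Option Act) : Option (Proc Act P) → PCls Act P γ
  | none => const c
  | some p => seq (const c) (mk γ p)

@[simp] theorem pre_none (o : Option (Proc Act P)) : pre none o = (0 : PCls Act P γ) := by
  cases o <;> simp [pre]

end PCls

/-- A summand of a process in head normal form: a condition, an action (or deadlock), and the
process that remains, or termination. -/
abbrev Summand (Act P : Type*) := Fm P × Option Act × Option (Proc Act P)

namespace PCls

/-- The process that is the sum of a list of summands. -/
def sum (γ : Option Act → Option Act → Option Act) (L : List (Summand Act P)) : PCls Act P γ :=
  (L.map fun e => gc e.1 (pre e.2.1 e.2.2)).sum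

@[simp] theorem sum_nil : sum γ ([] : List (Summand Act P)) = 0 := rfl

@[simp] theorem sum_cons (φ : Fm P) (c : Option Act) (o : Option (Proc Act P)) (L) :
    sum γ ((φ, c, o) :: L) = gc φ (pre c o) + sum γ L := by simp [sum]

@[simp] theorem sum_append (L M : List (Summand Act P)) :
    sum γ (L ++ M) = sum γ L + sum γ M := by simp [sum]

end PCls

/-! ### Syntactic operations on lists of summands -/

namespace Summand

/-- The summands of `x · y`, given those of `x`. -/
def seq (L : List (Summand Act P)) (y : Proc Act P) : List (Summand Act P) :=
  L.map fun e => (e.1, e.2.1, some (e.2.2.elim y (.seq · y)))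

/-- The summands of `ψ :→ x`, given those of `x`. -/
def gc (ψ : Fm P) (L : List (Summand Act P)) : List (Summand Act P) :=
  L.map fun e => (.conj e.1 ψ, e.2.1, e.2.2)

/-- The summands of the encapsulation of `x`, given those of `x`. -/
noncomputable def encap (H : Set Act) (L : List (Summand Act P)) : List (Summand Act P) :=
  L.map fun e => (e.1, encapAct H e.2.1, e.2.2.map (.encap H))

/-- The summands of a left merge with `y`, where `r` is the operator applied to what remains. -/
def leftm (r : Proc Act P → Proc Act P → Proc Act P) (L : List (Summand Act P))
    (y : Proc Act P) : List (Summand Act P) :=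
  L.map fun e => (e.1, e.2.1, some (e.2.2.elim y (r · y)))

/-- The parallel composition of two processes that may have terminated. -/
def merge : Option (Proc Act P) → Option (Proc Act P) → Option (Proc Act P)
  | none, o => o
  | some x, none => some x
  | some x, some y => some (.par x y)

/-- The summand resulting from the communication of two summands. -/
def sync (γ : Option Act → Option Act → Option Act) (e e' : Summand Act P) : Summand Act P :=
  (.conj e.1 e'.1, γ e.2.1 e'.2.1, merge e.2.2 e'.2.2)

/-- The summands of a communication merge. -/
def comm (γ : Option Act → Option Act → Option Act) (L M : List (Summand Act P)) :
    List (Summand Act P) :=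
  L.flatMap fun e => M.map (sync γ e)

end Summand

/-! ### The process operators on sums of summands -/

namespace PCls

variable (L M : List (Summand Act P))

theorem sum_seq (y : Proc Act P) : sum γ (Summand.seq L y) = seq (sum γ L) (mk γ y) := by
  induction L with
  | nil => simp [Summand.seq]
  | cons e L ih =>
    obtain ⟨φ, c, o⟩ := e
    simp only [Summand.seq, List.map_cons, sum_cons, add_seq] at ih ⊢
    rw [ih, ← gc_seq]
    cases o <;> simp [pre, mk_seq, seq_assoc]

theorem sum_gc (ψ : Fm P) : sum γ (Summand.gc ψ L) = gc ψ (sum γ L) := by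
  induction L with
  | nil => simp [Summand.gc]
  | cons e L ih =>
    obtain ⟨φ, c, o⟩ := e
    simp only [Summand.gc, List.map_cons, sum_cons, gc_add] at ih ⊢
    rw [ih, gc_gc, gc_congr _ (φ := .conj φ ψ) (ψ := .conj ψ φ)]
    intro ν
    simp only [Fm.eval]
    cases φ.eval ν <;> cases ψ.eval ν <;> rfl

theorem encap_pre (H : Set Act) (c : Option Act) (o : Option (Proc Act P)) :
    encap H (pre c o) = (pre (encapAct H c) (o.map (.encap H)) : PCls Act P γ) := by
  cases o <;> simp [pre, encap_seq, mk_encap, encap_const]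

theorem sum_encap (H : Set Act) : sum γ (Summand.encap H L) = encap H (sum γ L) := by
  induction L with
  | nil => simp [Summand.encap]
  | cons e L ih =>
    obtain ⟨φ, c, o⟩ := e
    simp only [Summand.encap, List.map_cons, sum_cons, encap_add] at ih ⊢
    rw [ih, encap_gc, encap_pre]

@[simp] theorem encap_univ_pre (c : Option Act) (o : Option (Proc Act P)) :
    encap Set.univ (pre c o) = (0 : PCls Act P γ) := by
  cases c <;> simp [encap_pre, encapAct]

@[simp] theorem encap_univ_sum : encap Set.univ (sum γ L) = 0 := by
  induction L with
  | nil => simp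
  | cons e L ih => obtain ⟨φ, c, o⟩ := e; simp [encap_add, encap_gc, ih]

theorem pre_leftm (c : Option Act) (o : Option (Proc Act P)) (y : Proc Act P) :
    leftm (pre c o) (mk γ y) =
      pre c (some (o.elim y (.par · y))) + encap Set.univ (mk γ y) := by
  cases o
  · exact const_leftm _ _
  · exact const_seq_leftm _ _ _

/-- The axioms for left merge add `∂_A(y)`, which is the bare signal `t` of `y`, and so keep that
signal outside the guards. A guarded summand contributes the signals `φ ⊃ t` and `t`, whose
conjunction is equivalent to `t`. -/
theorem sum_leftm {r : Proc Act P → Proc Act P → Proc Act P}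
    (hr : ∀ p q, mk γ (r p q) = mk γ (.par p q)) (y : Proc Act P) (t : Fm P)
    (hy : encap Set.univ (mk γ y) = emi t 0) :
    leftm (sum γ L) (mk γ y) = emi t (sum γ (Summand.leftm r L y)) := by
  induction L with
  | nil =>
    -- The empty sum is `δ`, and `δ ⌊⌊ y = δ · y + ∂_A(y)`, so it too emits `t`.
    have := const_leftm (mk γ y) none
    rw [hy] at this
    simpa [Summand.leftm] using this
  | cons e L ih =>
    obtain ⟨φ, c, o⟩ := e
    have ho : (pre c (some (o.elim y (.par · y))) : PCls Act P γ) =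
        pre c (some (o.elim y (r · y))) := by
      cases o <;> simp [pre, hr]
    simp only [Summand.leftm, List.map_cons, sum_cons, add_leftm] at ih ⊢
    rw [ih, gc_leftm, pre_leftm, hy, gc_add, gc_emi, gc_zero, add_assoc (gc φ _), emi_add,
      add_comm (gc φ _), emi_add_left, emi_add, ho, zero_add, zero_add]
    refine emi_congr _ fun ν => ?_
    simp only [Fm.eval]
    cases φ.eval ν <;> cases t.eval ν <;> rfl

variable (γ_comm : ∀ a b, γ a b = γ b a) (γ_dead : ∀ a, γ none a = none)

theorem pre_comm_pre (c d : Option Act) (o o' : Option (Proc Act P)) :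
    comm (pre c o) (pre d o') = (pre (γ c d) (Summand.merge o o') : PCls Act P γ) := by
  rcases o with _ | x <;> rcases o' with _ | y
  · exact const_comm_const _ _
  · exact const_comm_seq _ _ _
  · exact seq_comm_const _ _ _
  · exact seq_comm_seq _ _ _ _

-- The terms `∂_A(·)` added by the axioms for guards vanish here, since sums of summands carry no
-- signal.
include γ_comm γ_dead in
theorem pre_comm_sum (φ : Fm P) (c : Option Act) (o : Option (Proc Act P)) :
    comm (gc φ (pre c o)) (sum γ M) = sum γ (M.map (Summand.sync γ (φ, c, o))) := by
  rw [gc_comm_merge, encap_univ_sum, add_zero]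
  induction M with
  | nil =>
    -- The empty sum is the constant `δ`, so this case is a communication with `δ`.
    have := pre_comm_pre (γ := γ) c none o none
    rw [γ_comm, γ_dead, pre_none, pre_none] at this
    simp [this]
  | cons e M ih =>
    obtain ⟨ψ, d, o'⟩ := e
    rw [List.map_cons, Summand.sync, sum_cons, sum_cons, ← ih]
    simp only [comm_merge_add, comm_merge_gc, encap_univ_pre, add_zero,
      gc_add, gc_gc, pre_comm_pre]

include γ_comm γ_dead in
theorem sum_comm_sum : comm (sum γ L) (sum γ M) = sum γ (Summand.comm γ L M) := by
  induction L with
  | nil =>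
    -- The empty sum is read as the single summand `T :→ δ`; all its communications are `δ`.
    have := pre_comm_sum M γ_comm γ_dead .tru none none
    rw [pre_none, gc_zero] at this
    rw [sum_nil, this]
    simp only [sum, Summand.comm, List.map_map, List.flatMap_nil, List.map_nil, List.sum_nil]
    exact List.sum_eq_zero (by simp +contextual [Summand.sync, γ_dead, eq_comm])
  | cons e L ih =>
    obtain ⟨φ, c, o⟩ := e
    rw [sum_cons, add_comm_merge, ih, pre_comm_sum M γ_comm γ_dead]
    simp [Summand.comm]

end PCls

/-- A bound on the number of actions that a process can perform in succession. -/
def Proc.depth : Proc Act P → ℕ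
  | .const _ => 1
  | .nex => 0
  | .gc _ x | .emi _ x | .encap _ x => x.depth
  | .alt x y | .seq x y | .par x y | .leftm x y | .comm x y => x.depth + y.depth

/-- The summands of a head normal form of a process; `r` is the operator applied to what remains
of the right argument of a parallel composition after its first action, and the left argument. -/
noncomputable def Proc.summands (γ : Option Act → Option Act → Option Act)
    (r : Proc Act P → Proc Act P → Proc Act P) : Proc Act P → List (Summand Act P)
  | .const c => [(.tru, c, none)]
  | .nex => []
  | .alt x y => x.summands γ r ++ y.summands γ r
  | .seq x y => Summand.seq (x.summands γ r) y
  | .gc ψ x => Summand.gc ψ (x.summands γ r)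
  | .emi _ x => x.summands γ r
  | .par x y => Summand.leftm .par (x.summands γ r) y ++ Summand.leftm r (y.summands γ r) x ++
      Summand.comm γ (x.summands γ r) (y.summands γ r)
  | .leftm x y => Summand.leftm .par (x.summands γ r) y
  | .comm x y => Summand.comm γ (x.summands γ r) (y.summands γ r)
  | .encap H x => Summand.encap H (x.summands γ r)

/-! ### Head normal forms and commutativity of parallel composition -/

section Expansion

variable {r : Proc Act P → Proc Act P → Proc Act P}

theorem Summand.depth_merge (o o' : Option (Proc Act P)) :
    (merge o o').elim 0 Proc.depth ≤ o.elim 0 Proc.depth + o'.elim 0 Proc.depth := by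
  cases o <;> cases o' <;> simp [merge, Proc.depth]

theorem Summand.depth_leftm (hr : ∀ x y, (r x y).depth = x.depth + y.depth)
    {L : List (Summand Act P)} {n : ℕ} (hL : ∀ e ∈ L, e.2.2.elim 0 Proc.depth < n)
    (y : Proc Act P) : ∀ e ∈ leftm r L y, e.2.2.elim 0 Proc.depth < n + y.depth := by
  simp only [leftm, List.mem_map]
  rintro _ ⟨⟨φ, c, o⟩, he, rfl⟩
  have := hL _ he
  cases o <;> simp_all

theorem Summand.depth_comm {L M : List (Summand Act P)} {m n : ℕ}
    (hL : ∀ e ∈ L, e.2.2.elim 0 Proc.depth < m) (hM : ∀ e ∈ M, e.2.2.elim 0 Proc.depth < n) :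
    ∀ e ∈ comm γ L M, e.2.2.elim 0 Proc.depth < m + n := by
  simp only [comm, List.mem_map, List.mem_flatMap]
  rintro _ ⟨e, he, e', he', rfl⟩
  have := hL _ he
  have := hM _ he'
  have := depth_merge e.2.2 e'.2.2
  simp only [sync]
  omega

/-- This makes induction on depth possible. Termination counts as depth `0`, which is why constants
have depth `1`. Only additivity of `r` is needed, so both `∥` and its swap are covered. -/
theorem Proc.depth_summand (hr : ∀ x y, (r x y).depth = x.depth + y.depth) (p : Proc Act P) :
    ∀ e ∈ p.summands γ r, e.2.2.elim 0 depth < p.depth := by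
  induction p with
  | const c => simp [summands, depth]
  | nex => simp [summands]
  | alt x y ihx ihy =>
    simp only [summands, List.mem_append, depth]
    rintro e (he | he)
    · have := ihx e he; omega
    · have := ihy e he; omega
  | seq x y ihx => exact Summand.depth_leftm (r := .seq) (fun _ _ => rfl) ihx y
  | gc ψ x ih =>
    simp only [summands, Summand.gc, List.mem_map]
    rintro _ ⟨e, he, rfl⟩
    exact ih e he
  | emi ψ x ih => exact ih
  | par x y ihx ihy =>
    simp only [summands, List.mem_append]
    rintro e ((he | he) | he)
    · exact Summand.depth_leftm (r := .par) (fun _ _ => rfl) ihx y e he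
    · rw [depth, Nat.add_comm]
      exact Summand.depth_leftm hr ihy x e he
    · exact Summand.depth_comm ihx ihy e he
  | leftm x y ihx => exact Summand.depth_leftm (r := .par) (fun _ _ => rfl) ihx y
  | comm x y ihx ihy => exact Summand.depth_comm ihx ihy
  | encap H x ih =>
    simp only [summands, Summand.encap, List.mem_map]
    rintro _ ⟨⟨φ, c, o⟩, he, rfl⟩
    have := ih _ he
    cases o <;> simp_all [depth]

open PCls

theorem encap_univ_mk {y : Proc Act P} {t : Fm P} {M : List (Summand Act P)}
    (hy : mk γ y = emi t (sum γ M)) : encap Set.univ (mk γ y) = emi t 0 := by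
  rw [hy, encap_emi, encap_univ_sum]

theorem leftm_expansion (hr : ∀ p q, mk γ (r p q) = mk γ (.par p q)) {x y : Proc Act P}
    {s t : Fm P} {L M : List (Summand Act P)} (hx : mk γ x = emi s (sum γ L))
    (hy : mk γ y = emi t (sum γ M)) :
    leftm (mk γ x) (mk γ y) = emi (.conj s t) (sum γ (Summand.leftm r L y)) := by
  rw [hx, emi_leftm, sum_leftm L hr y t (encap_univ_mk hy), emi_emi]

variable (γ_comm : ∀ a b, γ a b = γ b a) (γ_dead : ∀ a, γ none a = none)
include γ_comm γ_dead

theorem comm_expansion {x y : PCls Act P γ} {s t : Fm P} {L M : List (Summand Act P)}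
    (hx : x = emi s (sum γ L)) (hy : y = emi t (sum γ M)) :
    comm x y = emi (.conj s t) (sum γ (Summand.comm γ L M)) := by
  rw [hx, hy, emi_comm_merge, comm_merge_emi, emi_emi, sum_comm_sum L M γ_comm γ_dead]

/-- Every process equals a head normal form that emits the same signal. -/
theorem expansion (hr : ∀ p q, mk γ (r p q) = mk γ (.par p q)) (p : Proc Act P) :
    mk γ p = emi p.sgn (sum γ (p.summands γ r)) := by
  induction p with
  | const c => simp [Proc.sgn, Proc.summands, pre, const]
  | nex => simp [Proc.sgn, nex]
  | alt x y ihx ihy =>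
    rw [mk_alt, Proc.sgn, Proc.summands, sum_append, ← emi_add, ← ihx, ← ihy]
  | seq x y ihx => rw [mk_seq, Proc.sgn, Proc.summands, sum_seq, ← emi_seq, ← ihx]
  | gc ψ x ih => rw [mk_gc, Proc.sgn, Proc.summands, sum_gc, ← gc_emi, ← ih]
  | emi ψ x ih => rw [mk_emi, Proc.sgn, Proc.summands, ← emi_emi, ← ih]
  | par x y ihx ihy =>
    rw [mk_par, Proc.sgn, Proc.summands, par_eq, leftm_expansion (fun _ _ => rfl) ihx ihy,
      leftm_expansion hr ihy ihx, comm_expansion γ_comm γ_dead ihx ihy, emi_add, emi_add,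
      sum_append, sum_append]
    refine emi_congr _ fun ν => ?_
    simp only [Fm.eval]
    cases x.sgn.eval ν <;> cases y.sgn.eval ν <;> rfl
  | leftm x y ihx ihy => exact leftm_expansion (fun _ _ => rfl) ihx ihy
  | comm x y ihx ihy => exact comm_expansion γ_comm γ_dead ihx ihy
  | encap H x ih => rw [mk_encap, Proc.sgn, Proc.summands, sum_encap, ← encap_emi, ← ih]

/-- Parallel composition of closed terms is commutative. -/
theorem mk_par_swap (p q : Proc Act P) : mk γ (.par p q) = mk γ (.par q p) := by
  induction hn : p.depth + q.depth using Nat.strong_induction_on generalizing p q with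
  | _ n ih =>
  subst hn
  have hp := expansion (r := .par) γ_comm γ_dead (fun _ _ => rfl) p
  have hq := expansion (r := .par) γ_comm γ_dead (fun _ _ => rfl) q
  have dp := p.depth_summand (γ := γ) (r := .par) (fun _ _ => rfl)
  have dq := q.depth_summand (γ := γ) (r := .par) (fun _ _ => rfl)
  rw [mk_par, mk_par, par_eq, par_eq, add_comm (leftm _ _), comm_expansion γ_comm γ_dead hp hq,
    comm_expansion γ_comm γ_dead hq hp]
  generalize p.summands γ .par = L at *
  generalize q.summands γ .par = M at *
  -- The left merges merely change places. The communication merges are double sums in opposite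
  -- orders; corresponding terms differ by swapped conjunctions and by residuals `x ∥ y` and `y ∥
  -- x`, whose total depth is smaller.
  have hsum : sum γ (Summand.comm γ L M) = sum γ (Summand.comm γ M L) := by
    have hexp (L M : List (Summand Act P)) : sum γ (Summand.comm γ L M) =
        ((L : Multiset (Summand Act P)).map fun e => ((M : Multiset (Summand Act P)).map fun e' =>
          gc (.conj e.1 e'.1) (pre (γ e.2.1 e'.2.1) (Summand.merge e.2.2 e'.2.2))).sum).sum := by
      simp only [Multiset.map_coe, Multiset.sum_coe]
      induction L with
      | nil => rfl
      | cons e L ih =>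
        have h : Summand.comm γ (e :: L) M =
            M.map (Summand.sync γ e) ++ Summand.comm γ L M := rfl
        rw [h, sum_append, ih, sum]
        simp [Summand.sync, Function.comp_def]
    rw [hexp, hexp, Multiset.sum_map_sum_map]
    refine congrArg _ (Multiset.map_congr rfl fun e he => congrArg _
      (Multiset.map_congr rfl fun e' he' => ?_))
    obtain ⟨φ, c, o⟩ := e
    obtain ⟨ψ, d, o'⟩ := e'
    have h₁ := dq _ he
    have h₂ := dp _ he'
    rw [γ_comm, gc_congr _ (φ := .conj ψ φ) (ψ := .conj φ ψ)]
    · congr 1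
      rcases o with _ | x <;> rcases o' with _ | y <;> simp only [Summand.merge, pre]
      rw [ih _ (by simp_all; omega) y x rfl]
    · intro ν
      simp only [Fm.eval]
      cases φ.eval ν <;> cases ψ.eval ν <;> rfl
  rw [hsum]
  refine congrArg _ (emi_congr _ fun ν => ?_)
  simp only [Fm.eval]
  cases p.sgn.eval ν <;> cases q.sgn.eval ν <;> rfl

theorem mk_eq_nex {p : Proc Act P} (hp : IsFalsity p.sgn) : mk γ p = nex := by
  rw [expansion (r := .par) γ_comm γ_dead (fun _ _ => rfl) p, emi_congr _ hp, emi_fls]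

end Expansion
end Quotient
end CtACPps
namespace CtACPps

/-! ### Transitions and summands -/

section Transitions

variable {Act P : Type*} {γ : Option Act → Option Act → Option Act}

/-- The summands of a process that correspond to its transitions. -/
noncomputable abbrev Proc.transitions (γ : Option Act → Option Act → Option Act)
    (p : Proc Act P) : List (Summand Act P) :=
  p.summands γ fun x y => .par y x

/-- A transition to a process or, for `none`, to successful termination. -/
def Trans (γ : Option Act → Option Act → Option Act) (p : Proc Act P) (φ : Fm P) (a : Act) :
    Option (Proc Act P) → Prop
  | none => Term γ p φ a
  | some p' => Step γ p φ a p'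

theorem Summand.mem_comm {L M : List (Summand Act P)} {φ ψ : Fm P} {a b c : Act}
    {o o' : Option (Proc Act P)} (h₁ : (φ, some a, o) ∈ L) (h₂ : (ψ, some b, o') ∈ M)
    (h : γ (some a) (some b) = some c) :
    (.conj φ ψ, some c, merge o o') ∈ comm γ L M :=
  List.mem_flatMap.2 ⟨_, h₁, List.mem_map.2 ⟨_, h₂, by simp [sync, h]⟩⟩

theorem Term.mem_transitions {p : Proc Act P} {φ : Fm P} {a : Act} (h : Term γ p φ a) :
    (φ, some a, none) ∈ p.transitions γ := by
  induction h with
  | act a => simp [Proc.summands]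
  | altLeft _ _ ih => exact List.mem_append_left _ ih
  | altRight _ _ ih => exact List.mem_append_right _ ih
  | gc _ _ ih => exact List.mem_map.2 ⟨_, ih, rfl⟩
  | emi _ _ ih => exact ih
  | par _ _ h _ _ ih₁ ih₂ =>
    exact List.mem_append_right _ (Summand.mem_comm ih₁ ih₂ h)
  | comm _ _ h _ _ ih₁ ih₂ => exact Summand.mem_comm ih₁ ih₂ h
  | encap _ h ih => exact List.mem_map.2 ⟨_, ih, by simp [encapAct, h]⟩

/-- The swap built into `Proc.transitions` gives the residual `x ∥ y'` exactly as the step rule for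
the right component does. -/
theorem Step.mem_transitions {p p' : Proc Act P} {φ : Fm P} {a : Act} (h : Step γ p φ a p') :
    (φ, some a, some p') ∈ p.transitions γ := by
  induction h with
  | altLeft _ _ ih => exact List.mem_append_left _ ih
  | altRight _ _ ih => exact List.mem_append_right _ ih
  | seqTerm h _ => exact List.mem_map.2 ⟨_, h.mem_transitions, rfl⟩
  | seqStep _ ih => exact List.mem_map.2 ⟨_, ih, rfl⟩
  | gc _ _ ih => exact List.mem_map.2 ⟨_, ih, rfl⟩
  | emi _ _ ih => exact ih
  | parLeftTerm h _ _ =>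
    exact List.mem_append_left _ (List.mem_append_left _
      (List.mem_map.2 ⟨_, h.mem_transitions, rfl⟩))
  | parRightTerm h _ _ =>
    exact List.mem_append_left _ (List.mem_append_right _
      (List.mem_map.2 ⟨_, h.mem_transitions, rfl⟩))
  | parLeftStep _ _ _ ih =>
    exact List.mem_append_left _ (List.mem_append_left _ (List.mem_map.2 ⟨_, ih, rfl⟩))
  | parRightStep _ _ _ ih =>
    exact List.mem_append_left _ (List.mem_append_right _ (List.mem_map.2 ⟨_, ih, rfl⟩))
  | parTermStep h₁ _ h _ _ ih =>
    exact List.mem_append_right _ (Summand.mem_comm h₁.mem_transitions ih h)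
  | parStepTerm _ h₂ h _ _ ih =>
    exact List.mem_append_right _ (Summand.mem_comm ih h₂.mem_transitions h)
  | parStepStep _ _ h _ _ _ ih₁ ih₂ =>
    exact List.mem_append_right _ (Summand.mem_comm ih₁ ih₂ h)
  | leftmTerm h _ _ => exact List.mem_map.2 ⟨_, h.mem_transitions, rfl⟩
  | leftmStep _ _ _ ih => exact List.mem_map.2 ⟨_, ih, rfl⟩
  | commTermStep h₁ _ h _ _ ih => exact Summand.mem_comm h₁.mem_transitions ih h
  | commStepTerm _ h₂ h _ _ ih => exact Summand.mem_comm ih h₂.mem_transitions h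
  | commStepStep _ _ h _ _ _ ih₁ ih₂ => exact Summand.mem_comm ih₁ ih₂ h
  | encap _ h ih => exact List.mem_map.2 ⟨_, ih, by simp [encapAct, h]⟩

theorem not_isFalsity_of_eval_ne {A : Fm P} {ν : P → TV} (h : A.eval ν ≠ .f) :
    ¬ IsFalsity A := fun hA => h (hA ν)

theorem eval_conj_ne {A B : Fm P} {ν : P → TV} :
    (Fm.conj A B).eval ν ≠ .f ↔ A.eval ν ≠ .f ∧ B.eval ν ≠ .f := by
  simp only [Fm.eval]
  cases A.eval ν <;> cases B.eval ν <;> simp [TV.conj]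

theorem not_isFalsity_of_conj {A B : Fm P} (h : ¬ IsFalsity (.conj A B)) :
    ¬ IsFalsity A ∧ ¬ IsFalsity B := by
  constructor <;> refine fun hA => h fun ν => by_contra fun hν => ?_
  · exact (eval_conj_ne.1 hν).1 (hA ν)
  · exact (eval_conj_ne.1 hν).2 (hA ν)

theorem Summand.of_mem_comm (γ_comm : ∀ a b, γ a b = γ b a) (γ_dead : ∀ a, γ none a = none)
    {L M : List (Summand Act P)} {φ : Fm P} {c : Act} {o : Option (Proc Act P)}
    (h : (φ, some c, o) ∈ comm γ L M) :
    ∃ φ₁ φ₂ a b o₁ o₂, (φ₁, some a, o₁) ∈ L ∧ (φ₂, some b, o₂) ∈ M ∧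
      γ (some a) (some b) = some c ∧ φ = .conj φ₁ φ₂ ∧ o = merge o₁ o₂ := by
  obtain ⟨⟨φ₁, a, o₁⟩, h₁, h'⟩ := List.mem_flatMap.1 h
  obtain ⟨⟨φ₂, b, o₂⟩, h₂, h''⟩ := List.mem_map.1 h'
  simp only [sync, Prod.mk.injEq] at h''
  obtain ⟨rfl, hc, rfl⟩ := h''
  rcases a with _ | a
  · simp [γ_dead] at hc
  rcases b with _ | b
  · simp [γ_comm _ none, γ_dead] at hc
  exact ⟨φ₁, φ₂, a, b, o₁, o₂, h₁, h₂, hc, rfl, rfl⟩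

variable {ν : P → TV} (γ_comm : ∀ a b, γ a b = γ b a) (γ_dead : ∀ a, γ none a = none)
include γ_comm γ_dead

/-- A summand whose condition is compatible with the signal and that does not lead to an
inconsistent state is a transition. -/
theorem trans_of_mem (p : Proc Act P) {φ : Fm P} {a : Act} {o : Option (Proc Act P)}
    (hmem : (φ, some a, o) ∈ p.transitions γ) (hp : p.sgn.eval ν ≠ .f) (hφ : φ.eval ν ≠ .f)
    (ho : ∀ p' ∈ o, ¬ IsFalsity p'.sgn) : Trans γ p φ a o := by
  have hok := not_isFalsity_of_eval_ne hp
  induction p generalizing φ a o with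
  | const c =>
    simp only [Proc.transitions, Proc.summands, List.mem_singleton, Prod.mk.injEq] at hmem
    obtain ⟨rfl, rfl, rfl⟩ := hmem
    exact .act a
  | nex => simp [Proc.summands] at hmem
  | alt x y ihx ihy =>
    obtain ⟨hx, hy⟩ := eval_conj_ne.1 hp
    rcases List.mem_append.1 hmem with hmem | hmem
    · have := ihx hmem hx hφ ho (not_isFalsity_of_eval_ne hx)
      cases o
      · exact .altLeft this hok
      · exact .altLeft this hok
    · have := ihy hmem hy hφ ho (not_isFalsity_of_eval_ne hy)
      cases o
      · exact .altRight this hok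
      · exact .altRight this hok
  | seq x y ihx =>
    obtain ⟨⟨φ, c, o⟩, hm, h⟩ := List.mem_map.1 hmem
    cases h
    cases o with
    | none => exact .seqTerm (ihx hm hp hφ (by simp) hok) (ho _ rfl)
    | some x' =>
      exact .seqStep (ihx hm hp hφ (by rintro _ ⟨⟩; exact ho (.seq x' y) rfl) hok)
  | gc ψ x ih =>
    obtain ⟨⟨φ, c, o⟩, hm, h⟩ := List.mem_map.1 hmem
    cases h
    obtain ⟨hφ', hψ⟩ := eval_conj_ne.1 hφ
    -- Here the common valuation matters: `ψ` is non-false at `ν`, so `ψ ⊃ s(x)` has the value of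
    -- `s(x)` there.
    have hx : x.sgn.eval ν ≠ .f := by
      intro h
      simp only [Proc.sgn, Fm.eval, h] at hp hψ
      cases h' : ψ.eval ν <;> simp_all [TV.impl]
    have := ih hm hx hφ' ho (not_isFalsity_of_eval_ne hx)
    cases o
    · exact .gc this (not_isFalsity_of_eval_ne hφ)
    · exact .gc this (not_isFalsity_of_eval_ne hφ)
  | emi ψ x ih =>
    have hx := (eval_conj_ne.1 hp).2
    have := ih hmem hx hφ ho (not_isFalsity_of_eval_ne hx)
    cases o
    · exact .emi this hok
    · exact .emi this hok
  | par x y ihx ihy =>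
    obtain ⟨hx, hy⟩ := eval_conj_ne.1 hp
    have hx' := not_isFalsity_of_eval_ne hx
    have hy' := not_isFalsity_of_eval_ne hy
    rcases List.mem_append.1 hmem with hmem | hmem
    · rcases List.mem_append.1 hmem with hmem | hmem
      · obtain ⟨⟨φ, c, o⟩, hm, h⟩ := List.mem_map.1 hmem
        cases h
        cases o with
        | none => exact .parLeftTerm (ihx hm hx hφ (by simp) hx') hok hy'
        | some x' =>
          refine .parLeftStep (ihx hm hx hφ ?_ hx') hok (ho _ rfl)
          rintro _ ⟨⟩
          exact (not_isFalsity_of_conj (ho _ rfl)).1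
      · obtain ⟨⟨φ, c, o⟩, hm, h⟩ := List.mem_map.1 hmem
        cases h
        cases o with
        | none => exact .parRightTerm (ihy hm hy hφ (by simp) hy') hok hx'
        | some y' =>
          refine .parRightStep (ihy hm hy hφ ?_ hy') hok (ho _ rfl)
          rintro _ ⟨⟩
          exact (not_isFalsity_of_conj (ho _ rfl)).2
    · obtain ⟨φ₁, φ₂, a, b, o₁, o₂, h₁, h₂, h, rfl, rfl⟩ :=
        Summand.of_mem_comm γ_comm γ_dead hmem
      obtain ⟨hφ₁, hφ₂⟩ := eval_conj_ne.1 hφ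
      have hn := not_isFalsity_of_eval_ne hφ
      have ih₁ := (ihx h₁ hx hφ₁ · hx')
      have ih₂ := (ihy h₂ hy hφ₂ · hy')
      rcases o₁ with _ | x' <;> rcases o₂ with _ | y'
      · exact .par (ih₁ (by simp)) (ih₂ (by simp)) h hn hok
      · exact .parTermStep (ih₁ (by simp)) (ih₂ ho) h hn hok
      · exact .parStepTerm (ih₁ ho) (ih₂ (by simp)) h hn hok
      · obtain ⟨hx₁, hy₁⟩ := not_isFalsity_of_conj (ho _ rfl)
        exact .parStepStep (ih₁ (by rintro _ ⟨⟩; exact hx₁)) (ih₂ (by rintro _ ⟨⟩; exact hy₁))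
          h hn hok (ho _ rfl)
  | leftm x y ihx =>
    obtain ⟨hx, hy⟩ := eval_conj_ne.1 hp
    have hx' := not_isFalsity_of_eval_ne hx
    obtain ⟨⟨φ, c, o⟩, hm, h⟩ := List.mem_map.1 hmem
    cases h
    cases o with
    | none => exact .leftmTerm (ihx hm hx hφ (by simp) hx') hok (not_isFalsity_of_eval_ne hy)
    | some x' =>
      refine .leftmStep (ihx hm hx hφ ?_ hx') hok (ho _ rfl)
      rintro _ ⟨⟩
      exact (not_isFalsity_of_conj (ho _ rfl)).1
  | comm x y ihx ihy =>
    obtain ⟨hx, hy⟩ := eval_conj_ne.1 hp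
    obtain ⟨φ₁, φ₂, a, b, o₁, o₂, h₁, h₂, h, rfl, rfl⟩ :=
      Summand.of_mem_comm γ_comm γ_dead hmem
    obtain ⟨hφ₁, hφ₂⟩ := eval_conj_ne.1 hφ
    have hn := not_isFalsity_of_eval_ne hφ
    have ih₁ := (ihx h₁ hx hφ₁ · (not_isFalsity_of_eval_ne hx))
    have ih₂ := (ihy h₂ hy hφ₂ · (not_isFalsity_of_eval_ne hy))
    rcases o₁ with _ | x' <;> rcases o₂ with _ | y'
    · exact .comm (ih₁ (by simp)) (ih₂ (by simp)) h hn hok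
    · exact .commTermStep (ih₁ (by simp)) (ih₂ ho) h hn hok
    · exact .commStepTerm (ih₁ ho) (ih₂ (by simp)) h hn hok
    · obtain ⟨hx₁, hy₁⟩ := not_isFalsity_of_conj (ho _ rfl)
      exact .commStepStep (ih₁ (by rintro _ ⟨⟩; exact hx₁)) (ih₂ (by rintro _ ⟨⟩; exact hy₁))
        h hn hok (ho _ rfl)
  | encap H x ih =>
    obtain ⟨⟨φ, c, o⟩, hm, h⟩ := List.mem_map.1 hmem
    simp only [Prod.mk.injEq] at h
    obtain ⟨rfl, h, rfl⟩ := h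
    rcases c with _ | b
    · simp [encapAct] at h
    by_cases hb : b ∈ H
    · simp [encapAct, hb] at h
    simp only [encapAct, hb, if_false, Option.some.injEq] at h
    subst h
    cases o with
    | none => exact .encap (ih hm hp hφ (by simp) hok) hb
    | some x' => exact .encap (ih hm hp hφ (by rintro _ ⟨⟩; exact ho (.encap H x') rfl) hok) hb

end Transitions

/-! ### Bisimilar processes are derivably equal -/

section Completeness

open PCls

variable {Act P : Type*} {γ : Option Act → Option Act → Option Act}

/-- The conditions of the summands in `L` that equal `u` apart from their condition can be
joined. -/
theorem exists_join (L : List (Summand Act P)) (u : PCls Act P γ) :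
    ∃ χ : Fm P, sum γ L + gc χ u = sum γ L ∧ ∀ e ∈ L, pre e.2.1 e.2.2 = u →
      ∀ ν, (χ.eval ν).disj (e.1.eval ν) = χ.eval ν := by
  induction L with
  | nil => exact ⟨.fls, by simp, by simp⟩
  | cons e L ih =>
    obtain ⟨φ, c, o⟩ := e
    obtain ⟨χ, h₁, h₂⟩ := ih
    by_cases hu : pre c o = u
    · refine ⟨.disj φ χ, ?_, ?_⟩
      · rw [sum_cons, gc_disj, add_add_add_comm, h₁, hu, add_self]
      · rintro e he heu ν
        rcases List.mem_cons.1 he with rfl | he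
        · simp only [Fm.eval]
          cases φ.eval ν <;> cases χ.eval ν <;> rfl
        · have := h₂ e he heu ν
          simp only [Fm.eval]
          revert this
          cases φ.eval ν <;> cases χ.eval ν <;> cases e.1.eval ν <;> simp [TV.disj]
    · refine ⟨χ, by rw [sum_cons, add_assoc, h₁], ?_⟩
      rintro e he heu
      rcases List.mem_cons.1 he with rfl | he
      · exact absurd heu hu
      · exact h₂ e he heu

/-- Under an emitted signal, conditions matter only where the signal does not evaluate to
false. -/
theorem emi_gc_congr {s φ ψ : Fm P} (x u : PCls Act P γ)
    (h : ∀ ν, s.eval ν ≠ .f → φ.eval ν = ψ.eval ν) :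
    emi s (x + gc φ u) = emi s (x + gc ψ u) := by
  -- The double implication `(s ⊃ F) ⊃ F` is the two-valued test for `s` being non-false. Guarding
  -- by `s` itself could lower a value `t` to `b`.
  have key (χ : Fm P) : emi s (x + gc χ u) =
      emi s (x + gc (.conj (.impl (.impl s .fls) .fls) χ) u) := by
    have hs : emi s (gc (.impl (.impl s .fls) .fls) (gc χ u)) = emi s (gc χ u) := by
      rw [← emi_gc_self (gc _ _), gc_gc, gc_congr _ (ψ := s), emi_gc_self]
      intro ν
      simp only [Fm.eval]
      cases s.eval ν <;> rfl
    rw [add_comm, add_comm x, ← emi_add_left, ← emi_add_left, ← gc_gc, hs]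
  rw [key, key ψ, gc_congr]
  intro ν
  have := h ν
  simp only [Fm.eval]
  revert this
  cases s.eval ν <;> cases φ.eval ν <;> cases ψ.eval ν <;> simp [TV.impl, TV.conj]

/-- The matching summand may depend on `ν`; this is where splitting is handled. The join `χ` of all
conditions in `L` guarding `u` is available as a summand, and wherever `s` is non-false its value is
at least that of `φ`. -/
theorem emi_sum_absorb {s φ : Fm P} {L : List (Summand Act P)} {u : PCls Act P γ}
    (h : ∀ ν, s.eval ν ≠ .f → φ.eval ν ≠ .f →
      ∃ e ∈ L, φ.eval ν = e.1.eval ν ∧ pre e.2.1 e.2.2 = u) :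
    emi s (sum γ L + gc φ u) = emi s (sum γ L) := by
  obtain ⟨χ, h₁, h₂⟩ := exists_join L u
  rw [← h₁, add_assoc, ← gc_disj]
  refine emi_gc_congr _ _ fun ν hν => ?_
  simp only [Fm.eval]
  by_cases hφ : φ.eval ν = .f
  · rw [hφ]
    cases χ.eval ν <;> rfl
  · obtain ⟨e, he, heq, heu⟩ := h ν hν hφ
    rw [heq]
    exact h₂ e he heu ν

theorem emi_sum_absorb_list {s : Fm P} {L M : List (Summand Act P)}
    (h : ∀ e ∈ M, emi s (sum γ L + gc e.1 (pre e.2.1 e.2.2)) = emi s (sum γ L)) :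
    emi s (sum γ L + sum γ M) = emi s (sum γ L) := by
  induction M with
  | nil => simp
  | cons e M ih =>
    have he := h e (by simp)
    have ih := ih fun e he => h e (by simp [he])
    obtain ⟨φ, c, o⟩ := e
    rw [sum_cons, ← add_assoc, ← emi_add_left, he, emi_add_left, ih]

/-! ### Mutual absorption of bisimilar processes -/

variable (γ_comm : ∀ a b, γ a b = γ b a) (γ_dead : ∀ a, γ none a = none)

theorem IsBisimulation.flip {R : Proc Act P → Proc Act P → Prop} (hR : IsBisimulation γ R) :
    IsBisimulation γ (flip R) where
  step_left p q h := hR.step_right q p h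
  step_right p q h := hR.step_left q p h
  term_left p q h := hR.term_right q p h
  term_right p q h := hR.term_left q p h
  sgn p q h ν := (hR.sgn q p h ν).symm

include γ_comm γ_dead

/-- One half of the argument. The induction hypothesis is restricted in both depths, so that the
lemma also applies to the flipped relation in an induction on the depth of one side. -/
theorem absorb_of_bisimulation {R : Proc Act P → Proc Act P → Prop} (hR : IsBisimulation γ R)
    {p q : Proc Act P} (hpq : R p q)
    (ih : ∀ p' q', p'.depth < p.depth → q'.depth < q.depth → R p' q' → mk γ p' = mk γ q') :
    emi p.sgn (sum γ (q.transitions γ) + sum γ (p.transitions γ)) =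
      emi p.sgn (sum γ (q.transitions γ)) := by
  have depth_lt {p p' : Proc Act P} {φ : Fm P} {c : Option Act}
      (h : (φ, c, some p') ∈ p.transitions γ) : p'.depth < p.depth :=
    p.depth_summand (fun x y => Nat.add_comm _ _) _ h
  refine emi_sum_absorb_list fun e he => ?_
  obtain ⟨φ, c, o⟩ := e
  rcases c with _ | a
  · simp
  rcases o with _ | p'
  · refine emi_sum_absorb fun ν hν hφ => ?_
    obtain ⟨ψ, hψ, hq⟩ := hR.term_left p q hpq φ a
      (trans_of_mem γ_comm γ_dead p he hν hφ (by simp)) ν hν hφ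
    exact ⟨_, hq.mem_transitions, hψ, rfl⟩
  -- An inconsistent target is outside the scope of `trans_of_mem`, but then the summand is zero by
  -- `a · ⊥ = δ`.
  · by_cases hp' : IsFalsity p'.sgn
    · simp [pre, mk_eq_nex γ_comm γ_dead hp']
    refine emi_sum_absorb fun ν hν hφ => ?_
    obtain ⟨ψ, q', hψ, hq, hR'⟩ := hR.step_left p q hpq φ a p'
      (trans_of_mem γ_comm γ_dead p he hν hφ (by rintro _ ⟨⟩; exact hp')) ν hν hφ
    refine ⟨_, hq.mem_transitions, hψ, ?_⟩
    simp only [pre]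
    rw [ih p' q' (depth_lt he) (depth_lt hq.mem_transitions) hR']

theorem IsBisimulation.class_eq {R : Proc Act P → Proc Act P → Prop} (hR : IsBisimulation γ R)
    (p q : Proc Act P) (hpq : R p q) : PCls.mk γ p = PCls.mk γ q := by
  induction hn : p.depth using Nat.strong_induction_on generalizing p q with
  | _ n ih =>
  subst hn
  -- Commutativity of `∥` permits the swapped residuals, so this expansion is over the list
  -- `Proc.transitions`.
  have exp := expansion (P := P) (r := fun x y => .par y x) γ_comm γ_dead
    fun x y => mk_par_swap γ_comm γ_dead y x
  have h₁ := absorb_of_bisimulation γ_comm γ_dead hR hpq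
    fun p' q' hp _ h => ih _ hp p' q' h rfl
  have h₂ := absorb_of_bisimulation γ_comm γ_dead hR.flip hpq
    fun q' p' _ hp h => (ih _ hp p' q' h rfl).symm
  have hs := hR.sgn p q hpq
  rw [exp p, exp q]
  calc emi p.sgn (sum γ (p.transitions γ))
    _ = emi q.sgn (sum γ (p.transitions γ)) := emi_congr _ hs
    _ = emi q.sgn (sum γ (p.transitions γ) + sum γ (q.transitions γ)) := h₂.symm
    _ = emi p.sgn (sum γ (q.transitions γ) + sum γ (p.transitions γ)) := by
      rw [add_comm, emi_congr _ hs]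
    _ = emi p.sgn (sum γ (q.transitions γ)) := h₁
    _ = emi q.sgn (sum γ (q.transitions γ)) := emi_congr _ hs

end Completeness
end CtACPps

theorem mainTheorem1 {Act AProp : Type*} [Finite Act] [Finite AProp]
    (γ : Option Act → Option Act → Option Act)
    (γ_comm : ∀ a b, γ a b = γ b a)
    (γ_assoc : ∀ a b c, γ (γ a b) c = γ a (γ b c))
    (γ_dead : ∀ a, γ none a = none)
    (p q : CtACPps.Proc Act AProp) (h : CtACPps.Bisim γ p q) :
    CtACPps.Der γ p q := by
  obtain ⟨R, hR, hpq⟩ := h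
  exact CtACPps.PCls.mk_eq_mk.1 (hR.class_eq γ_comm γ_dead p q hpq)
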